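/- **Model.** An instance $I$ of election control by edge removal (ECER) or edge addition (ECEA) consists of: a finite non-empty set $V$ of voters; candidates $c_0,\dots,c_\ell$ with $\ell\ge 1$; injective score functions $\pi_v:\{0,\dots,\ell\}\to\mathbb N$ ($v\in V$); a set $S\subseteq V$ of seeds, each $s\in S$ with a message $m_s\in\mathbb Z^{\ell+1}$; a set $E\subseteq V\times V$ of edges; rational probabilities $p:V\times V\to[0,1]$; and a budget $B\in\mathbb N\cup\{\infty\}$. Let $H\subseteq V\times V$ be random, containing each pair $e$ independently with probability $p(e)$. If the edge set is $A$, the message $m_s$ spreads from $s$ along the edges of $A\cap H$ and influences all voters that it reaches ($s$ included). The final score of $c_i$ for $v$ is $(1-\epsilon)\pi_v(i)+\sum_s m_s(i)$, the sum being over the seeds whose message influences $v$, where $\epsilon=1/(1+\max_{v,i}\pi_v(i))$; every voter votes for the candidate with the highest final score. $\mathsf{MoV}(A,H)$ is the number of votes of $c_0$ minus the largest number of votes of another candidate. A feasible solution is a set $F\subseteq V\times V$ with $|F|\le B$ and $F\subseteq E$ (removal) or $F\cap E=\emptyset$ (addition); its gain $\Delta_I(F)$ is $\mathbb E_H[\mathsf{MoV}(E\setminus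 F,H)-\mathsf{MoV}(E,H)]$, respectively $\mathbb E_H[\mathsf{MoV}(E\cup F,H)-\mathsf{MoV}(E,H)]$, and is to be maximized. A feasible $F$ is a $\rho$-approximation if $\Delta_I(F)\ge\rho\,\Delta_I(F')$ for all feasible $F'$. A reoptimization input is $R=(I,E^*,e,o)$ with $E^*$ an optimal solution of $I$, $e\in E$ and $o\in[0,1]\cap\mathbb Q$; the task is to solve the instance $I_1$ obtained from $I$ by changing $p(e)$ to $o$. Sizes are lengths of encodings with numbers in binary. The spread of $I$ is $\max_v\{\max_i\pi_v(i)-\min_i\pi_v(i)\}$. For a polynomial $q$ let $\mathcal C_q$ be the class of instances whose spread is at most $q(\mathrm{size}(I))$. Scores are unitary if all $\pi_v(i)\in\{0,\dots,\ell\}$. **Theorem.** Fix removal or addition, and a polynomial $q$. Reoptimization is as hard as optimization on $\mathcal C_q$: there are algorithms $f,g$ and a polynomial $r$ bounding their running times such that the following holds. 1. For every $I\in\mathcal C_q$, $f$ computes from $I$ a reoptimization input $R=(I',E^*,e,o)$ such that $E^*$ is an optimal solution of $I'$, $I'\in\mathcal C_q$, $I'$ has the same number of candidates and the same budget as $I$,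 and $I'$ has unitary scores if $I$ has. From $I$ and any feasible solution $F$ of the changed instance $I'_1$, $g$ computes a feasible solution $F'$ of $I$ with $\Delta_I(F')=\Delta_{I'_1}(F)$. Conversely, every value $\Delta_I(F')$ of a feasible solution $F'$ of $I$ is the value of a feasible solution of $I'_1$. (So the optima agree, and $g$ maps optimal solutions to optimal solutions and $\rho$-approximations to $\rho$-approximations.) 2. Consequently, hardness results carry over to reoptimization. Let $\mathcal K\subseteq\mathcal C_q$ be any class of instances, and let $\rho,\rho':\mathbb N\to[0,\infty)$ satisfy $\rho'(n)\le\rho(m)$ whenever $m\le r(n)$ (for instance $\rho=\rho'$ constant). If no polynomial-time algorithm returns a $\rho'(\mathrm{size})$-approximation for all instances in $\mathcal K$, then no polynomial-time algorithm returns a $\rho(\mathrm{size})$-approximation for all reoptimization inputs $(I',E^*,e,o)$ such that $I'\in\mathcal C_q$ and, for some $I\in\mathcal K$, $I'$ has the same number of candidates and the same budget as $I$, and unitary scores if $I$ has. -/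

import Mathlib

/-! ### Computation model: structured programs on binary trees, with a cost measure -/

/-- Binary trees, the data on which programs work. -/
inductive Data : Type
  | nil : Data
  | cons : Data → Data → Data

/-- The number of nodes of a tree. -/
def Data.size : Data → ℕ
  | .nil => 1
  | .cons a b => a.size + b.size + 1

/-- Programs of the (one-variable) WHILE language on binary trees. The tree `nil` is the truth
value "false", every other tree is "true". -/
inductive Prog : Type
  /-- return `nil` -/
  | nil : Prog
  /-- return the input -/
  | id : Prog
  /-- left subtree of the input (`nil` if the input is `nil`) -/
  | hd : Prog
  /-- right subtree of the input (`nil` if the input is `nil`) -/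
  | tl : Prog
  /-- `pair f g` returns `cons (f x) (g x)` -/
  | pair : Prog → Prog → Prog
  /-- `seq f g` runs `f`, then `g` on the result of `f` -/
  | seq : Prog → Prog → Prog
  /-- `ite c f g` runs `f` on the input if `c` returns true on it, and `g` otherwise -/
  | ite : Prog → Prog → Prog → Prog
  /-- `loop c f` replaces the current value `x` by `f x` as long as `c` returns true on `x` -/
  | loop : Prog → Prog → Prog

/-- `Runs c x y t`: the program `c` halts on input `x` with output `y` and total cost `t`.
Every elementary step costs one unit plus the number of nodes of the tree it delivers, so that
the cost is polynomially related to the running time of a Turing machine. -/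
inductive Prog.Runs : Prog → Data → Data → ℕ → Prop
  | nil (x : Data) : Runs .nil x .nil (1 + Data.nil.size)
  | id (x : Data) : Runs .id x x (1 + x.size)
  | hd_nil : Runs .hd .nil .nil (1 + Data.nil.size)
  | hd_cons (a b : Data) : Runs .hd (.cons a b) a (1 + a.size)
  | tl_nil : Runs .tl .nil .nil (1 + Data.nil.size)
  | tl_cons (a b : Data) : Runs .tl (.cons a b) b (1 + b.size)
  | pair {f g : Prog} {x a b : Data} {s t : ℕ} :
      Runs f x a s → Runs g x b t →
      Runs (.pair f g) x (.cons a b) (s + t + (1 + (Data.cons a b).size))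
  | seq {f g : Prog} {x y z : Data} {s t : ℕ} :
      Runs f x y s → Runs g y z t → Runs (.seq f g) x z (s + t + 1)
  | ite_true {c f g : Prog} {x a b y : Data} {s t : ℕ} :
      Runs c x (.cons a b) s → Runs f x y t → Runs (.ite c f g) x y (s + t + 1)
  | ite_false {c f g : Prog} {x y : Data} {s t : ℕ} :
      Runs c x .nil s → Runs g x y t → Runs (.ite c f g) x y (s + t + 1)
  | loop_done {c f : Prog} {x : Data} {s : ℕ} :
      Runs c x .nil s → Runs (.loop c f) x x (s + (1 + x.size))
  | loop_step {c f : Prog} {x a b y z : Data} {s t u : ℕ} :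
      Runs c x (.cons a b) s → Runs f x y t → Runs (.loop c f) y z u →
      Runs (.loop c f) x z (s + t + u + 1)

/-- On input `x`, the program `c` outputs `y`, with cost at most `r (size of x)`. -/
def Prog.RunsWithin (c : Prog) (r : Polynomial ℕ) (x y : Data) : Prop :=
  ∃ t ≤ r.eval x.size, c.Runs x y t

/-! ### Encoding of basic objects (numbers in binary) -/

namespace Data

def ofList (l : List Data) : Data := l.foldr Data.cons Data.nil

def ofBool : Bool → Data
  | false => .nil
  | true => .cons .nil .nil

/-- Binary representation, least significant bit first. -/
def ofNat (n : ℕ) : Data := ofList (n.bits.map ofBool)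

/-- Sign and absolute value. -/
def ofInt (z : ℤ) : Data := .cons (ofBool (decide (z < 0))) (ofNat z.natAbs)

/-- Numerator and denominator in lowest terms. -/
def ofRat (x : ℚ) : Data := .cons (ofInt x.num) (ofNat x.den)

def ofOption : Option Data → Data
  | none => .nil
  | some d => .cons .nil d

/-- The list of the values of a function on `Fin n`. -/
def ofFamily {n : ℕ} (f : Fin n → Data) : Data := ofList (List.ofFn f)

/-- A set of ordered pairs, as its 0-1 matrix. -/
def ofEdges {n : ℕ} (F : Finset (Fin n × Fin n)) : Data :=
  ofFamily fun u => ofFamily fun v => ofBool (decide ((u, v) ∈ F))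

end Data

/-! ### Election control -/

/-- An instance of election control by modification of the edges: voters `Fin n`, candidates
`c_0, …, c_ℓ`, scores, seeds with their messages, edges, influence probabilities and budget. -/
structure Instance where
  /-- number of voters -/
  n : ℕ
  n_pos : 0 < n
  /-- there are `ℓ + 1` candidates, and at least two; the manipulator's candidate is `c_0` -/
  ℓ : ℕ
  ℓ_pos : 0 < ℓ
  /-- `score v i` is the score that voter `v` gives to candidate `c_i` -/
  score : Fin n → Fin (ℓ + 1) → ℕ
  score_injective : ∀ v, Function.Injective (score v)
  /-- `message v` is the message sent by `v` if `v` is a seed, and `none` if `v` is not -/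
  message : Fin n → Option (Fin (ℓ + 1) → ℤ)
  /-- the edges of the network -/
  edges : Finset (Fin n × Fin n)
  /-- the strength of the (potential) influence, on all ordered pairs of voters -/
  prob : Fin n × Fin n → ℚ
  prob_nonneg : ∀ e, 0 ≤ prob e
  prob_le_one : ∀ e, prob e ≤ 1
  /-- the budget, possibly infinite -/
  budget : ℕ∞

/-- The two forms of manipulation. -/
inductive Modification : Type
  | removal
  | addition

/-- Diffusion of the message of `s` along a graph `L`, up to time `t`: the first component is
the set of voters activated exactly at time `t`, the second one is the set of voters activated at
some time `≤ t`. -/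
def diffusion {n : ℕ} (L : Finset (Fin n × Fin n)) (s : Fin n) :
    ℕ → Finset (Fin n) × Finset (Fin n)
  | 0 => ({s}, {s})
  | t + 1 =>
    let old := diffusion L s t
    let new := Finset.univ.filter fun v => v ∉ old.2 ∧ ∃ u ∈ old.1, (u, v) ∈ L
    (new, old.2 ∪ new)

/-- The message of `s`, spreading along `L`, activates `v` at some time. -/
def Influenced {n : ℕ} (L : Finset (Fin n × Fin n)) (s v : Fin n) : Prop :=
  ∃ t, v ∈ (diffusion L s t).1

namespace Instance

/-- The tie-breaking parameter `1 / (1 + max_{v,i} π_v(i))`. -/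
def eps (I : Instance) : ℚ :=
  1 / (1 + ((Finset.univ.sup fun v => Finset.univ.sup fun i => I.score v i : ℕ) : ℚ))

/-- The information on `c_i` in the message of `s` (`0` if `s` is not a seed). -/
def news (I : Instance) (s : Fin I.n) (i : Fin (I.ℓ + 1)) : ℤ :=
  match I.message s with
  | none => 0
  | some m => m i

open Classical in
/-- The score of `c_i` for voter `v` after the diffusion along `L`. The factor `1 - ε` on the
initial score breaks ties in favour of the candidate initially ranked lower. -/
noncomputable def finalScore (I : Instance) (L : Finset (Fin I.n × Fin I.n)) (v : Fin I.n)
    (i : Fin (I.ℓ + 1)) : ℚ :=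
  (1 - I.eps) * (I.score v i : ℚ) +
    ((∑ s ∈ Finset.univ.filter (fun s => (I.message s).isSome ∧ Influenced L s v),
      I.news s i : ℤ) : ℚ)

open Classical in
/-- The voters who rank `c` first after the diffusion along `L`. -/
noncomputable def votersFor (I : Instance) (L : Finset (Fin I.n × Fin I.n))
    (c : Fin (I.ℓ + 1)) : Finset (Fin I.n) :=
  Finset.univ.filter fun v => ∀ j, j ≠ c → I.finalScore L v j < I.finalScore L v c

/-- Margin of victory of `c_0` if the edge set is `A` and the set of live pairs is `H`. -/
noncomputable def mov (I : Instance) (A H : Finset (Fin I.n × Fin I.n)) : ℤ :=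
  ((I.votersFor (A ∩ H) 0).card : ℤ) -
    (((Finset.univ.filter fun c : Fin (I.ℓ + 1) => c ≠ 0).sup
      fun c => (I.votersFor (A ∩ H) c).card : ℕ) : ℤ)

/-- The probability that `H` is the set of live pairs: every ordered pair `e` of voters is live
with probability `prob e`, independently. -/
def liveProb (I : Instance) (H : Finset (Fin I.n × Fin I.n)) : ℚ :=
  ∏ e, if e ∈ H then I.prob e else 1 - I.prob e

/-- The edge set after the manipulation `F`. -/
def modify (I : Instance) (F : Finset (Fin I.n × Fin I.n)) :
    Modification → Finset (Fin I.n × Fin I.n)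
  | .removal => I.edges \ F
  | .addition => I.edges ∪ F

/-- The expected increase of the margin of victory due to `F`. -/
noncomputable def gain (I : Instance) (k : Modification) (F : Finset (Fin I.n × Fin I.n)) : ℚ :=
  ∑ H, I.liveProb H * ((I.mov (I.modify F k) H - I.mov I.edges H : ℤ) : ℚ)

/-- Feasible manipulations. -/
def Feasible (I : Instance) (k : Modification) (F : Finset (Fin I.n × Fin I.n)) : Prop :=
  (match k with
    | .removal => F ⊆ I.edges
    | .addition => Disjoint F I.edges) ∧ (F.card : ℕ∞) ≤ I.budget

/-- Optimal solutions. -/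
def IsOptimal (I : Instance) (k : Modification) (F : Finset (Fin I.n × Fin I.n)) : Prop :=
  I.Feasible k F ∧ ∀ F', I.Feasible k F' → I.gain k F' ≤ I.gain k F

/-- `F` is feasible and its gain is at least `ρ` times that of the best solution. -/
def IsApprox (I : Instance) (k : Modification) (ρ : NNReal) (F : Finset (Fin I.n × Fin I.n)) :
    Prop :=
  I.Feasible k F ∧ ∀ F', I.Feasible k F' → (ρ : ℝ) * (I.gain k F' : ℝ) ≤ (I.gain k F : ℝ)

/-- `max_v (max_i π_v(i) - min_i π_v(i))`. -/
def spread (I : Instance) : ℕ :=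
  Finset.univ.sup fun v =>
    Finset.univ.sup' Finset.univ_nonempty (I.score v) -
      Finset.univ.inf' Finset.univ_nonempty (I.score v)

/-- Unitary score distances: every voter uses the scores `0, …, ℓ`. -/
def Unitary (I : Instance) : Prop := ∀ v i, I.score v i ≤ I.ℓ

def encode (I : Instance) : Data :=
  .cons
    (Data.ofFamily fun v =>
      .cons (Data.ofFamily fun i => Data.ofNat (I.score v i))
        (Data.ofOption ((I.message v).map fun m => Data.ofFamily fun i => Data.ofInt (m i))))
    (.cons
      (Data.ofFamily fun u => Data.ofFamily fun v =>
        .cons (Data.ofBool (decide ((u, v) ∈ I.edges))) (Data.ofRat (I.prob (u, v))))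
      (match I.budget with
        | none => Data.ofOption none
        | some b => Data.ofOption (some (Data.ofNat b))))

/-- The size of an instance. -/
def size (I : Instance) : ℕ := I.encode.size

/-- The score spread is at most `q (size of the instance)`. -/
def SpreadBounded (q : Polynomial ℕ) (I : Instance) : Prop := I.spread ≤ q.eval I.size

/-- Same number of candidates and same budget; unitary score distances are kept. -/
def SameSetting (I I' : Instance) : Prop :=
  I'.ℓ = I.ℓ ∧ I'.budget = I.budget ∧ (I.Unitary → I'.Unitary)

end Instance

/-- An input of the reoptimization problem: an instance, a solution of it, a pair of voters and
a new probability for this pair. -/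
structure ReoptInstance where
  inst : Instance
  sol : Finset (Fin inst.n × Fin inst.n)
  edge : Fin inst.n × Fin inst.n
  newProb : ℚ
  newProb_nonneg : 0 ≤ newProb
  newProb_le_one : newProb ≤ 1

namespace ReoptInstance

/-- The instance that has to be solved: the probability of the edge is changed. -/
def modified (R : ReoptInstance) : Instance :=
  { R.inst with
    prob := Function.update R.inst.prob R.edge R.newProb
    prob_nonneg := by
      intro e
      by_cases h : e = R.edge
      · subst h; simpa using R.newProb_nonneg
      · simpa [Function.update_of_ne h] using R.inst.prob_nonneg e
    prob_le_one := by
      intro e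
      by_cases h : e = R.edge
      · subst h; simpa using R.newProb_le_one
      · simpa [Function.update_of_ne h] using R.inst.prob_le_one e }

/-- Admissible inputs: the given solution is optimal for the given instance, and the pair whose
probability changes is an edge of the network. -/
def Valid (k : Modification) (R : ReoptInstance) : Prop :=
  R.inst.IsOptimal k R.sol ∧ R.edge ∈ R.inst.edges

def encode (R : ReoptInstance) : Data :=
  .cons R.inst.encode (.cons (Data.ofEdges R.sol)
    (.cons (.cons (Data.ofNat R.edge.1) (Data.ofNat R.edge.2)) (Data.ofRat R.newProb)))

/-- The size of a reoptimization input. -/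
def size (R : ReoptInstance) : ℕ := R.encode.size

end ReoptInstance

/-- There is a polynomial-time algorithm that returns a `ρ`-approximation (`ρ` may depend on the
size) for every instance in the class `K` of the optimization problem. -/
def OptApproximable (k : Modification) (K : Set Instance) (ρ : ℕ → NNReal) : Prop :=
  ∃ (c : Prog) (r : Polynomial ℕ), ∀ I ∈ K,
    ∃ F, I.IsApprox k (ρ I.size) F ∧ c.RunsWithin r I.encode (Data.ofEdges F)

/-- There is a polynomial-time algorithm that, given an instance in the class `K` together with
an optimal solution and a change of the probability of one edge, returns a `ρ`-approximation for
the changed instance. -/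
def ReoptApproximable (k : Modification) (K : Set Instance) (ρ : ℕ → NNReal) : Prop :=
  ∃ (c : Prog) (r : Polynomial ℕ), ∀ R : ReoptInstance, R.Valid k → R.inst ∈ K →
    ∃ F, R.modified.IsApprox k (ρ R.size) F ∧ c.RunsWithin r R.encode (Data.ofEdges F)

/-! ### Polynomial-time functions on trees -/

/-! Two voters are put in front of the old ones. Both rank `c_0` first. Voter 0 is a seed promoting
`c_0` by `2 ^ I.size`, more than all scores and messages of `I` can outweigh; its message can leave
only along the edge (0,1), and voter 1 has edges of probability 1 to all old voters. All other new
pairs are non-edges of probability 0. If (0,1) has probability 1, everybody almost surely votes for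
`c_0`. The margin is then maximal without intervention, so the empty set is an optimal solution that
costs nothing to write down (`isOptimal_extend_one`). If that probability drops to 0, the message
stays at voter 0 and voter 1 receives nothing. Diffusion among the old voters is that of `I`, the
two new votes shift every margin by 2, and the gain of a manipulation is that of its restriction to
old pairs (`extend_zero_gain`). Knowing the old optimum is therefore of no help. The new voters use
scores `0, …, ℓ`. Since scores are injective, `ℓ` is at most the old maximum and the old spread, so
`ε`, the spread bound and unitarity survive. The remaining work is algorithmic: polynomial-time
functions on trees are closed under composition, branching and recursion along lists with
polynomially bounded results, and the reduction is written with these tools.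
`optApproximable_of_reopt` then composes it with a reoptimization algorithm. -/

theorem Polynomial.eval_mono_nat (r : Polynomial ℕ) {m n : ℕ} (h : m ≤ n) :
    r.eval m ≤ r.eval n := by
  rw [Polynomial.eval_eq_sum_range, Polynomial.eval_eq_sum_range]
  gcongr

namespace Data

/-- Left subtree. -/
def left : Data → Data
  | nil => nil
  | cons a _ => a

/-- Right subtree. -/
def right : Data → Data
  | nil => nil
  | cons _ b => b

/-- Case distinction on the truth value of a tree. -/
def cond (c x y : Data) : Data :=
  match c with
  | nil => y
  | cons _ _ => x

@[simp] theorem left_nil : left nil = nil := rfl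
@[simp] theorem left_cons (a b : Data) : left (cons a b) = a := rfl
@[simp] theorem right_nil : right nil = nil := rfl
@[simp] theorem right_cons (a b : Data) : right (cons a b) = b := rfl
@[simp] theorem cond_nil (x y : Data) : cond nil x y = y := rfl
@[simp] theorem cond_cons (a b x y : Data) : cond (cons a b) x y = x := rfl
@[simp] theorem size_nil : size nil = 1 := rfl
@[simp] theorem size_cons (a b : Data) : size (cons a b) = a.size + b.size + 1 := rfl

theorem size_pos (x : Data) : 0 < x.size := by cases x <;> simp

theorem size_left_le (x : Data) : x.left.size ≤ x.size := by
  cases x <;> simp; omega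

/-- Number of nodes on the right spine. -/
def spineLength : Data → ℕ
  | nil => 0
  | cons _ b => b.spineLength + 1

theorem spineLength_le_size (x : Data) : x.spineLength ≤ x.size := by
  induction x with
  | nil => simp [spineLength]
  | cons a b _ ih => simp [spineLength]; omega

end Data

theorem Prog.Runs.size_le {c : Prog} {x y : Data} {t : ℕ} (h : c.Runs x y t) : y.size ≤ t := by
  induction h <;> omega

/-- `f` is computed by a program in polynomial time. -/
def PolyTime (f : Data → Data) : Prop :=
  ∃ (c : Prog) (r : Polynomial ℕ), ∀ x, c.RunsWithin r x (f x)

theorem Prog.RunsWithin.size_le {c : Prog} {r : Polynomial ℕ} {x y : Data}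
    (h : c.RunsWithin r x y) : y.size ≤ r.eval x.size := by
  obtain ⟨t, ht, hr⟩ := h
  exact hr.size_le.trans ht

theorem Prog.RunsWithin.mono {c : Prog} {r r' : Polynomial ℕ} {x y : Data}
    (h : c.RunsWithin r x y) (hr : ∀ n, r.eval n ≤ r'.eval n) : c.RunsWithin r' x y := by
  obtain ⟨t, ht, h⟩ := h
  exact ⟨t, ht.trans (hr _), h⟩

theorem Prog.RunsWithin.seq {c d : Prog} {r r' : Polynomial ℕ} {x y z : Data}
    (h : c.RunsWithin r x y) (h' : d.RunsWithin r' y z) :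
    (Prog.seq c d).RunsWithin (r + r'.comp r + 1) x z := by
  have hy := h.size_le
  obtain ⟨s, hs, h⟩ := h
  obtain ⟨t, ht, h'⟩ := h'
  refine ⟨_, ?_, h.seq h'⟩
  have := r'.eval_mono_nat hy
  simp only [Polynomial.eval_add, Polynomial.eval_comp, Polynomial.eval_one]
  omega

theorem Prog.RunsWithin.pair {c d : Prog} {r r' : Polynomial ℕ} {x y z : Data}
    (h : c.RunsWithin r x y) (h' : d.RunsWithin r' x z) :
    (Prog.pair c d).RunsWithin (r + r + r' + r' + 2) x (.cons y z) := by
  have hy := h.size_le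
  have hz := h'.size_le
  obtain ⟨s, hs, h⟩ := h
  obtain ⟨t, ht, h'⟩ := h'
  refine ⟨_, ?_, h.pair h'⟩
  simp only [Polynomial.eval_add, Polynomial.eval_ofNat, Data.size_cons]
  omega

theorem Prog.RunsWithin.id (x : Data) : Prog.id.RunsWithin (1 + Polynomial.X) x x :=
  ⟨_, by simp, .id x⟩

namespace PolyTime

theorem size_le {f : Data → Data} (hf : PolyTime f) :
    ∃ r : Polynomial ℕ, ∀ x, (f x).size ≤ r.eval x.size := by
  obtain ⟨c, r, h⟩ := hf
  exact ⟨r, fun x => (h x).size_le⟩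

theorem id : PolyTime fun x => x := ⟨_, _, Prog.RunsWithin.id⟩

theorem pair {f g : Data → Data} (hf : PolyTime f) (hg : PolyTime g) :
    PolyTime fun x => .cons (f x) (g x) := by
  obtain ⟨c, r, h⟩ := hf
  obtain ⟨c', r', h'⟩ := hg
  exact ⟨_, _, fun x => (h x).pair (h' x)⟩

theorem comp {g f : Data → Data} (hg : PolyTime g) (hf : PolyTime f) :
    PolyTime fun x => g (f x) := by
  obtain ⟨c, r, h⟩ := hf
  obtain ⟨c', r', h'⟩ := hg
  exact ⟨_, _, fun x => (h x).seq (h' _)⟩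

theorem const (d : Data) : PolyTime fun _ => d := by
  induction d with
  | nil => exact ⟨.nil, 2, fun x => ⟨_, by simp, .nil x⟩⟩
  | cons a b iha ihb => exact iha.pair ihb

theorem left {f : Data → Data} (hf : PolyTime f) : PolyTime fun x => (f x).left := by
  refine PolyTime.comp (g := Data.left) ⟨.hd, 1 + Polynomial.X, fun x => ?_⟩ hf
  cases x with
  | nil => exact ⟨_, by simp, .hd_nil⟩
  | cons a b => exact ⟨_, by simp; omega, .hd_cons a b⟩

theorem right {f : Data → Data} (hf : PolyTime f) : PolyTime fun x => (f x).right := by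
  refine PolyTime.comp (g := Data.right) ⟨.tl, 1 + Polynomial.X, fun x => ?_⟩ hf
  cases x with
  | nil => exact ⟨_, by simp, .tl_nil⟩
  | cons a b => exact ⟨_, by simp; omega, .tl_cons a b⟩

theorem cond {c f g : Data → Data} (hc : PolyTime c) (hf : PolyTime f) (hg : PolyTime g) :
    PolyTime fun x => (c x).cond (f x) (g x) := by
  obtain ⟨pc, rc, hc⟩ := hc
  obtain ⟨pf, rf, hf⟩ := hf
  obtain ⟨pg, rg, hg⟩ := hg
  refine ⟨.ite pc pf pg, rc + rf + rg + 1, fun x => ?_⟩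
  obtain ⟨s, hs, hc⟩ := hc x
  obtain ⟨t, ht, hf⟩ := hf x
  obtain ⟨u, hu, hg⟩ := hg x
  simp only [Prog.RunsWithin, Polynomial.eval_add, Polynomial.eval_one]
  cases h : c x with
  | nil =>
    rw [h] at hc
    exact ⟨_, by omega, .ite_false hc hg⟩
  | cons a b =>
    rw [h] at hc
    exact ⟨_, by omega, .ite_true hc hf⟩

end PolyTime

/-- Cost of a loop that runs as long as the left subtree is true. `P m x` says that `x` is a
state from which `m` further steps lead to the output `y`. -/
theorem Prog.loop_runs {p : Prog} {r : Polynomial ℕ} {s : Data → Data}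
    (hs : ∀ x, p.RunsWithin r x (s x)) {B : ℕ} {P : ℕ → Data → Prop} {y : Data}
    (h0 : ∀ x, P 0 x → x.left = .nil ∧ x = y)
    (hS : ∀ m x, P (m + 1) x → x.left ≠ .nil ∧ P m (s x))
    (hB : ∀ m x, P m x → x.size ≤ B) (m : ℕ) :
    ∀ x, P m x → ∃ t ≤ (m + 1) * (r.eval B + 2 * B + 5), (Prog.loop .hd p).Runs x y t := by
  have hd : ∀ x : Data, Prog.hd.Runs x x.left (1 + x.left.size) := by
    intro x
    cases x with
    | nil => exact .hd_nil
    | cons a b => exact .hd_cons a b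
  induction m with
  | zero =>
    intro x hx
    obtain ⟨hl, rfl⟩ := h0 x hx
    have := hB _ _ hx
    have h := hd x
    have hsz := x.size_left_le
    rw [hl] at h hsz
    exact ⟨_, by omega, .loop_done h⟩
  | succ m ih =>
    intro x hx
    obtain ⟨hl, hP⟩ := hS m x hx
    obtain ⟨u, hu, hrun⟩ := ih _ hP
    obtain ⟨t, ht, hstep⟩ := hs x
    have hx' := hB _ _ hx
    have hr := r.eval_mono_nat hx'
    have h := hd x
    have hsz := x.size_left_le
    cases hxl : x.left with
    | nil => exact absurd hxl hl
    | cons a b =>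
      rw [hxl] at h hsz
      refine ⟨_, ?_, .loop_step h hstep hrun⟩
      rw [Nat.succ_mul (m + 1)]
      omega

/-- `P x m z` is the loop invariant: on input `x`, the state `z` needs exactly `m` more steps. `K`
bounds the number of steps and `B` the size of every state; without `B`, polynomially many steps
could still build exponentially large trees. -/
theorem PolyTime.loop {s i G : Data → Data} (hs : PolyTime s) (hi : PolyTime i)
    (K B : Polynomial ℕ) (P : Data → ℕ → Data → Prop)
    (hinit : ∀ x, ∃ m ≤ K.eval x.size, P x m (i x))
    (h0 : ∀ x z, P x 0 z → z.left = .nil ∧ z = G x)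
    (hS : ∀ x m z, P x (m + 1) z → z.left ≠ .nil ∧ P x m (s z))
    (hB : ∀ x m z, P x m z → z.size ≤ B.eval x.size) : PolyTime G := by
  obtain ⟨p, r, hp⟩ := hs
  obtain ⟨c, r', hc⟩ := hi
  refine ⟨.seq c (.loop .hd p), r' + (K + 1) * (r.comp B + 2 * B + 5) + 1, fun x => ?_⟩
  obtain ⟨m, hm, hP⟩ := hinit x
  obtain ⟨t, ht, h⟩ := Prog.loop_runs hp (h0 x) (hS x) (hB x) m _ hP
  obtain ⟨u, hu, h'⟩ := hc x
  refine ⟨_, ?_, h'.seq h⟩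
  have : (m + 1) * (r.eval (B.eval x.size) + 2 * B.eval x.size + 5) ≤
      (K.eval x.size + 1) * (r.eval (B.eval x.size) + 2 * B.eval x.size + 5) := by gcongr
  simp only [Polynomial.eval_add, Polynomial.eval_mul, Polynomial.eval_comp, Polynomial.eval_one,
    Polynomial.eval_ofNat]
  omega

/-! ### Recursion along the right spine -/

namespace Data

/-- Primitive recursion along the right spine; the step gets the current subtree and the value
on its right subtree. -/
def spineRec (e : Data) (s : Data → Data) : Data → Data
  | nil => e
  | cons a b => s (cons (cons a b) (spineRec e s b))

@[simp] theorem spineRec_nil (e : Data) (s : Data → Data) : spineRec e s nil = e := rfl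
@[simp] theorem spineRec_cons (e : Data) (s : Data → Data) (a b : Data) :
    spineRec e s (cons a b) = s (cons (cons a b) (spineRec e s b)) := rfl

/-- Push the non-empty spine suffixes of a tree on a stack. -/
def pushSuffixes : Data → Data → Data
  | nil, st => st
  | cons a b, st => pushSuffixes b (cons (cons a b) st)

/-- `Ascends x m z st`: the stack `st` holds the `m` spine suffixes of `x` that properly
contain the suffix `z`, the shortest one on top. -/
def Ascends (x : Data) : ℕ → Data → Data → Prop
  | 0, z, st => z = x ∧ st = nil
  | m + 1, z, st => ∃ a st', st = cons (cons a z) st' ∧ Ascends x m (cons a z) st'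

/-- The stacked suffixes share no memory, so the stack is charged for every copy: at most `x.size`
suffixes of at most `x.size` nodes each, hence a quadratic bound. -/
theorem Ascends.size_le {x : Data} {m : ℕ} :
    ∀ {z st : Data}, Ascends x m z st → m + z.size ≤ x.size ∧ st.size ≤ m * (x.size + 1) + 1 := by
  induction m with
  | zero =>
    rintro z st ⟨rfl, rfl⟩
    simp
  | succ m ih =>
    rintro z st ⟨a, st', rfl, h⟩
    obtain ⟨h1, h2⟩ := ih h
    have := a.size_pos
    simp only [size_cons] at h1 ⊢
    rw [Nat.succ_mul]
    omega

theorem Ascends.stack_size_le {x z st : Data} {m : ℕ} (h : Ascends x m z st) :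
    st.size ≤ x.size * (x.size + 1) + 1 := by
  obtain ⟨h1, h2⟩ := h.size_le
  have : m * (x.size + 1) ≤ x.size * (x.size + 1) := by gcongr; omega
  omega

theorem Ascends.pushSuffixes {x : Data} : ∀ {m : ℕ} {z st : Data}, Ascends x m z st →
    ∃ k, Ascends x k nil (z.pushSuffixes st)
  | m, nil, _, h => ⟨m, h⟩
  | m, cons a b, st, h => by
    have h' : Ascends x (m + 1) b (cons (cons a b) st) := ⟨a, st, rfl, h⟩
    exact h'.pushSuffixes

end Data

theorem PolyTime.pushSuffixes : PolyTime fun x => x.pushSuffixes .nil := by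
  -- A loop stops when the left component of its state is `nil`, so it delivers its result paired
  -- with `nil`; `right` removes this.
  have key : PolyTime fun x => .cons .nil (x.pushSuffixes .nil) := by
    refine PolyTime.loop (s := fun z => .cons z.left.right (.cons z.left z.right))
      (i := fun x => .cons x .nil) (K := .X) (B := .X + .X * (.X + 1) + 2)
      (P := fun x m z => ∃ y st k, z = .cons y st ∧ y.spineLength = m ∧
        y.pushSuffixes st = x.pushSuffixes .nil ∧ Data.Ascends x k y st)
      (.pair id.left.right (.pair id.left id.right)) (.pair id (.const _)) ?_ ?_ ?_ ?_
    · intro x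
      refine ⟨_, ?_, x, .nil, 0, rfl, rfl, rfl, rfl, rfl⟩
      simpa using x.spineLength_le_size
    · rintro x _ ⟨y, st, k, rfl, hy, hp, -⟩
      cases y with
      | nil => exact ⟨rfl, by rw [← hp]; rfl⟩
      | cons a b => simp [Data.spineLength] at hy
    · rintro x m _ ⟨y, st, k, rfl, hy, hp, h⟩
      cases y with
      | nil => simp [Data.spineLength] at hy
      | cons a b =>
        refine ⟨by simp, b, _, k + 1, rfl, by simpa [Data.spineLength] using hy, hp, a, st, rfl, h⟩
    · rintro x m _ ⟨y, st, k, rfl, -, -, h⟩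
      have := h.size_le.1
      have := h.stack_size_le
      simp only [Data.size_cons, Polynomial.eval_add, Polynomial.eval_mul, Polynomial.eval_X,
        Polynomial.eval_one, Polynomial.eval_ofNat]
      omega
  exact key.right

/-- The language has loops but no recursion. The suffixes are stacked first; popping them, shortest
first, evaluates the recursion from the inside out. Each intermediate value is the value at a
suffix, so the bound `p` covers it. -/
theorem PolyTime.spineRec {e : Data} {s : Data → Data} (hs : PolyTime s) (p : Polynomial ℕ)
    (hp : ∀ x, (Data.spineRec e s x).size ≤ p.eval x.size) : PolyTime (Data.spineRec e s) := by
  have key : PolyTime fun x => .cons .nil (Data.spineRec e s x) := by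
    refine PolyTime.loop
      (s := fun z => .cons z.left.right (s (.cons z.left.left z.right)))
      (i := fun x => .cons (x.pushSuffixes .nil) e) (K := .X) (B := p + .X * (.X + 1) + 2)
      (P := fun x m z => ∃ y st, z = .cons st (Data.spineRec e s y) ∧ Data.Ascends x m y st)
      (.pair id.left.right (hs.comp (.pair id.left.left id.right)))
      (.pair .pushSuffixes (.const _)) ?_ ?_ ?_ ?_
    · intro x
      obtain ⟨k, hk⟩ := Data.Ascends.pushSuffixes (x := x) (m := 0) ⟨rfl, rfl⟩
      have := hk.size_le.1
      exact ⟨k, by simp; omega, .nil, _, rfl, hk⟩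
    · rintro x _ ⟨y, st, rfl, rfl, rfl⟩
      exact ⟨rfl, rfl⟩
    · rintro x m _ ⟨y, st, rfl, a, st', rfl, h⟩
      exact ⟨by simp, _, _, rfl, h⟩
    · rintro x m _ ⟨y, st, rfl, h⟩
      have := h.size_le.1
      have := h.stack_size_le
      have := hp y
      have := p.eval_mono_nat (show y.size ≤ x.size by omega)
      simp only [Data.size_cons, Polynomial.eval_add, Polynomial.eval_mul, Polynomial.eval_X,
        Polynomial.eval_one, Polynomial.eval_ofNat]
      omega
  exact key.right

/-! ### List operations: map, binary successor, countdown. -/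

namespace Data

/-- Apply `f` to all entries of a list. -/
def map (f : Data → Data) : Data → Data
  | nil => nil
  | cons a b => cons (f a) (map f b)

/-- Binary successor. -/
def succ : Data → Data
  | nil => cons (ofBool true) nil
  | cons a b => cond a (cons nil b.succ) (cons (ofBool true) b)

/-- For a list of length `n`, the list of the binary representations of `n - 1, …, 0`. -/
def countdown : Data → Data
  | nil => nil
  | cons _ b => cond b.countdown (cons b.countdown.left.succ b.countdown) (cons nil nil)

theorem size_succ_le (x : Data) : x.succ.size ≤ x.size + 4 := by
  induction x with
  | nil => simp [succ, ofBool]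
  | cons a b _ ih =>
    cases a <;> simp [succ, ofBool] <;> omega

/-- The head is bounded along with the list because each new entry is the successor of the previous
head, which adds at most 4 nodes. -/
theorem size_countdown_le (x : Data) :
    x.countdown.left.size ≤ 4 * x.size ∧ x.countdown.size ≤ (4 * x.size + 1) * x.size := by
  induction x with
  | nil => simp [countdown]
  | cons a b _ ih =>
    obtain ⟨h1, h2⟩ := ih
    have hs := size_succ_le b.countdown.left
    have ha := a.size_pos
    have hb := b.size_pos
    cases hc : b.countdown with
    | nil =>
      simp only [countdown, hc, cond_nil, left_cons, size_cons, size_nil]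
      constructor <;> nlinarith
    | cons c d =>
      rw [hc] at h1 h2 hs
      simp only [countdown, hc, cond_cons, left_cons, size_cons] at *
      constructor
      · omega
      · nlinarith

end Data

theorem PolyTime.map {f : Data → Data} (hf : PolyTime f) : PolyTime (Data.map f) := by
  have h : Data.map f = Data.spineRec .nil fun z => .cons (f z.left.left) z.right := by
    funext x
    induction x with
    | nil => rfl
    | cons a b _ ih => simp [Data.map, ih]
  obtain ⟨r, hr⟩ := hf.size_le
  rw [h]
  refine PolyTime.spineRec (.pair (hf.comp id.left.left) id.right) ((r + 1) * .X + 1) ?_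
  rw [← h]
  -- `N` stays fixed during the induction, so that every entry of every suffix obeys the same bound
  -- `r.eval N`.
  suffices ∀ N x : _, Data.size x ≤ N → (x.map f).size ≤ (r.eval N + 1) * x.size + 1 by
    intro x
    simpa using this _ x le_rfl
  intro N x
  induction x with
  | nil => simp [Data.map]
  | cons a b _ ih =>
    intro hN
    simp only [Data.size_cons] at hN
    have h1 := ih (by omega)
    have h2 := (hr a).trans (r.eval_mono_nat (show a.size ≤ N by omega))
    simp only [Data.map, Data.size_cons]
    nlinarith

theorem PolyTime.succ : PolyTime Data.succ := by
  have h : Data.succ = Data.spineRec (.cons (Data.ofBool true) .nil)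
      fun z => z.left.left.cond (.cons .nil z.right) (.cons (Data.ofBool true) z.left.right) := by
    funext x
    induction x with
    | nil => rfl
    | cons a b _ ih => simp [Data.succ, ih]
  rw [h]
  refine PolyTime.spineRec (.cond id.left.left (.pair (.const _) id.right)
    (.pair (.const _) id.left.right)) (.X + 4) ?_
  rw [← h]
  intro x
  simpa using x.size_succ_le

theorem PolyTime.countdown : PolyTime Data.countdown := by
  have h : Data.countdown = Data.spineRec .nil
      fun z => z.right.cond (.cons z.right.left.succ z.right) (.cons .nil .nil) := by
    funext x
    induction x with
    | nil => rfl
    | cons a b _ ih => simp [Data.countdown, ih]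
  rw [h]
  refine PolyTime.spineRec (.cond id.right (.pair (PolyTime.succ.comp id.right.left) id.right)
    (.const _)) ((4 * .X + 1) * .X) ?_
  rw [← h]
  intro x
  simpa using x.size_countdown_le.2

/-! ### A number exceeding all numbers in an encoding -/

namespace Data

/-- The binary representation of `2 ^ k`. -/
def powTwo : ℕ → Data
  | 0 => cons (ofBool true) nil
  | k + 1 => cons nil (powTwo k)

theorem size_powTwo (k : ℕ) : (powTwo k).size = 2 * k + 5 := by
  induction k with
  | zero => simp [powTwo, ofBool]
  | succ k ih => simp [powTwo, ih]; omega

theorem ofNat_two_pow (k : ℕ) : ofNat (2 ^ k) = powTwo k := by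
  induction k with
  | zero => simp [ofNat, powTwo, ofList]
  | succ k ih =>
    have : (2 ^ (k + 1)).bits = false :: (2 ^ k).bits := by
      rw [pow_succ, mul_comm]
      exact Nat.bit0_bits _ (by positivity)
    rw [powTwo, ← ih]
    simp [ofNat, this, ofList, ofBool]

/-- The sum of the sizes of the entries of a list. -/
def entrySizes : Data → ℕ
  | nil => 0
  | cons a b => a.size + entrySizes b

end Data

/-- The tree is dismantled on a work stack. Each step removes one node, popping a `nil` or splitting
a `cons` into its two subtrees, and doubles the number. So the exponent counts the nodes, and
splitting does not enlarge the stack. -/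
theorem PolyTime.powTwo_size : PolyTime fun x => Data.powTwo x.size := by
  have key : PolyTime fun x => .cons .nil (Data.powTwo x.size) := by
    refine PolyTime.loop
      (s := fun z => .cons (z.left.left.cond
          (.cons z.left.left.left (.cons z.left.left.right z.left.right)) z.left.right)
        (.cons .nil z.right))
      (i := fun x => .cons (.cons x .nil) (Data.powTwo 0)) (K := .X) (B := 3 * .X + 8)
      (P := fun x m z => ∃ st k, z = .cons st (Data.powTwo k) ∧ st.entrySizes = m ∧
        st.size ≤ x.size + 2 ∧ k + m = x.size)
      (.pair (.cond id.left.left (.pair id.left.left.left (.pair id.left.left.right id.left.right))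
        id.left.right) (.pair (.const _) id.right))
      (.pair (.pair id (.const _)) (.const _)) ?_ ?_ ?_ ?_
    · intro x
      exact ⟨x.size, by simp, _, 0, rfl, by simp [Data.entrySizes], by simp, by simp⟩
    · rintro x _ ⟨st, k, rfl, hm, -, hk⟩
      cases st with
      | nil => exact ⟨rfl, by rw [← hk]; rfl⟩
      | cons a b =>
        have := a.size_pos
        simp only [Data.entrySizes] at hm
        omega
    · rintro x m _ ⟨st, k, rfl, hm, hs, hk⟩
      cases st with
      | nil => simp [Data.entrySizes] at hm
      | cons a b =>
        refine ⟨by simp, _, k + 1, rfl, ?_, ?_, by omega⟩ <;>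
        cases a <;> simp [Data.entrySizes] at hm hs ⊢ <;> omega
    · rintro x m _ ⟨st, k, rfl, hm, hs, hk⟩
      simp only [Data.size_cons, Data.size_powTwo, Polynomial.eval_add, Polynomial.eval_mul,
        Polynomial.eval_X, Polynomial.eval_ofNat]
      omega
  exact key.right

/-! ### Influence as reachability -/

theorem diffusion_snd_influenced {n : ℕ} (L : Finset (Fin n × Fin n)) (s : Fin n) (t : ℕ) :
    ∀ v ∈ (diffusion L s t).2, Influenced L s v := by
  induction t with
  | zero => exact fun v hv => ⟨0, hv⟩
  | succ t ih =>
    intro v hv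
    rcases Finset.mem_union.1 hv with h | h
    · exact ih v h
    · exact ⟨t + 1, h⟩

theorem influenced_iff_reflTransGen {n : ℕ} (L : Finset (Fin n × Fin n)) (s v : Fin n) :
    Influenced L s v ↔ Relation.ReflTransGen (fun u w => (u, w) ∈ L) s v := by
  constructor
  · rintro ⟨t, ht⟩
    induction t generalizing v with
    | zero =>
      obtain rfl : v = s := by simpa [diffusion] using ht
      exact .refl
    | succ t ih =>
      obtain ⟨-, u, hu, huv⟩ := (Finset.mem_filter.1 ht).2
      exact (ih u hu).tail huv
  · intro h
    induction h with
    | refl => exact ⟨0, by simp [diffusion]⟩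
    | @tail u w _ huw ih =>
      obtain ⟨t, ht⟩ := ih
      -- An out-neighbour of a voter activated at time `t` is not newly activated only if it was
      -- activated earlier.
      by_cases hw : w ∈ (diffusion L s t).2
      · exact diffusion_snd_influenced L s t w hw
      · exact ⟨t + 1, Finset.mem_filter.2 ⟨Finset.mem_univ _, hw, u, ht, huw⟩⟩

/-! ### Two additional voters -/

/-- The position of an old voter after two voters have been put in front. -/
def shift {n : ℕ} (v : Fin n) : Fin (n + 2) := v.succ.succ

theorem shift_injective {n : ℕ} : Function.Injective (shift : Fin n → Fin (n + 2)) :=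
  (Fin.succ_injective _).comp (Fin.succ_injective _)

@[simp] theorem shift_inj {n : ℕ} {u v : Fin n} : shift u = shift v ↔ u = v :=
  shift_injective.eq_iff

@[simp] theorem shift_ne_zero {n : ℕ} (v : Fin n) : shift v ≠ 0 := Fin.succ_ne_zero _

@[simp] theorem shift_ne_one {n : ℕ} (v : Fin n) : shift v ≠ 1 := by
  rw [shift, ← Fin.succ_zero_eq_one, Ne, Fin.succ_inj]
  exact Fin.succ_ne_zero _

@[simp] theorem zero_ne_shift {n : ℕ} (v : Fin n) : 0 ≠ shift v := (shift_ne_zero v).symm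

@[simp] theorem one_ne_shift {n : ℕ} (v : Fin n) : 1 ≠ shift v := (shift_ne_one v).symm

theorem eq_zero_or_one_or_shift {n : ℕ} (v : Fin (n + 2)) :
    v = 0 ∨ v = 1 ∨ ∃ u, v = shift u := by
  refine Fin.cases (.inl rfl) (fun v => ?_) v
  exact Fin.cases (.inr (.inl rfl)) (fun u => .inr (.inr ⟨u, rfl⟩)) v

theorem forall_fin_add_two {n : ℕ} {P : Fin (n + 2) → Prop} :
    (∀ v, P v) ↔ P 0 ∧ P 1 ∧ ∀ v, P (shift v) := by
  rw [Fin.forall_fin_succ, Fin.forall_fin_succ]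
  rfl

theorem sum_fin_add_two {n : ℕ} {M : Type*} [AddCommMonoid M] (f : Fin (n + 2) → M) :
    ∑ v, f v = f 0 + (f 1 + ∑ v, f (shift v)) := by
  rw [Fin.sum_univ_succ, Fin.sum_univ_succ]
  rfl

/-- A family on the extended set of voters. -/
def extendFamily {α : Type*} {n : ℕ} (x y : α) (f : Fin n → α) : Fin (n + 2) → α :=
  Fin.cons x (Fin.cons y f)

section
variable {α : Type*} {n : ℕ} (x y : α) (f : Fin n → α)

@[simp] theorem extendFamily_zero : extendFamily x y f 0 = x := rfl
@[simp] theorem extendFamily_one : extendFamily x y f 1 = y := rfl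
@[simp] theorem extendFamily_shift (v : Fin n) : extendFamily x y f (shift v) = f v := rfl

end

/-- A matrix on the extended set of voters, with entry `x` at `(0, 1)`, entry `y` at `(1, v)` for
all old voters `v`, the entries of `f` on the old pairs, and entry `z` elsewhere. -/
def extendMatrix {α : Type*} {n : ℕ} (x y z : α) (f : Fin n → Fin n → α) :
    Fin (n + 2) → Fin (n + 2) → α :=
  extendFamily (extendFamily z x fun _ => z) (extendFamily z z fun _ => y)
    fun u => extendFamily z z (f u)

/-- The pairs of old voters in a set of pairs of voters. -/
def restrictEdges {n : ℕ} (L : Finset (Fin (n + 2) × Fin (n + 2))) : Finset (Fin n × Fin n) :=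
  Finset.univ.filter fun e => (shift e.1, shift e.2) ∈ L

@[simp] theorem mem_restrictEdges {n : ℕ} {L : Finset (Fin (n + 2) × Fin (n + 2))} {u v : Fin n} :
    (u, v) ∈ restrictEdges L ↔ (shift u, shift v) ∈ L := by
  simp [restrictEdges]

/-- A set of pairs of voters that is described by an extended matrix. -/
def extendEdges {n : ℕ} (x y : Bool) (L : Finset (Fin n × Fin n)) :
    Finset (Fin (n + 2) × Fin (n + 2)) :=
  Finset.univ.filter fun e => extendMatrix x y false (fun u v => decide ((u, v) ∈ L)) e.1 e.2

section
variable {n : ℕ} {x y : Bool} {L : Finset (Fin n × Fin n)}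

theorem mem_extendEdges {e : Fin (n + 2) × Fin (n + 2)} : e ∈ extendEdges x y L ↔
    extendMatrix x y false (fun u v => decide ((u, v) ∈ L)) e.1 e.2 = true := by
  simp [extendEdges]

@[simp] theorem restrictEdges_extendEdges : restrictEdges (extendEdges x y L) = L := by
  ext ⟨u, v⟩
  simp [mem_extendEdges, extendMatrix]

theorem extendEdges_injective : Function.Injective (extendEdges (n := n) x y) :=
  Function.LeftInverse.injective (g := restrictEdges) fun _ => restrictEdges_extendEdges

theorem card_restrictEdges_le (L : Finset (Fin (n + 2) × Fin (n + 2))) :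
    (restrictEdges L).card ≤ L.card := by
  refine Finset.card_le_card_of_injOn (fun e => (shift e.1, shift e.2)) ?_ ?_
  · rintro ⟨u, v⟩ h
    exact mem_restrictEdges.1 h
  · rintro ⟨u, v⟩ - ⟨u', v'⟩ - h
    simpa using h

theorem card_extendEdges_false (L : Finset (Fin n × Fin n)) :
    (extendEdges false false L).card = L.card := by
  have : extendEdges false false L = L.image fun e => (shift e.1, shift e.2) := by
    ext ⟨u, v⟩
    rw [mem_extendEdges]
    rcases eq_zero_or_one_or_shift u with rfl | rfl | ⟨u, rfl⟩ <;>
    rcases eq_zero_or_one_or_shift v with rfl | rfl | ⟨v, rfl⟩ <;>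
    simp [extendMatrix, eq_comm]
  rw [this, Finset.card_image_of_injective]
  rintro ⟨u, v⟩ ⟨u', v'⟩ h
  simpa using h

end

/-- No live pair starts at voter `0` or leads from an old voter to a new one. -/
def Separated {n : ℕ} (L : Finset (Fin (n + 2) × Fin (n + 2))) : Prop :=
  (∀ w, (0, w) ∉ L) ∧ ∀ u, (shift u, 0) ∉ L ∧ (shift u, 1) ∉ L

/-! ### Diffusion when the new voters cannot pass anything on. -/

namespace Separated
variable {n : ℕ} {L : Finset (Fin (n + 2) × Fin (n + 2))}

theorem mono {L' : Finset (Fin (n + 2) × Fin (n + 2))} (h : Separated L) (hL : L' ⊆ L) :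
    Separated L' :=
  ⟨fun w hw => h.1 w (hL hw), fun u => ⟨fun hu => (h.2 u).1 (hL hu), fun hu => (h.2 u).2 (hL hu)⟩⟩

theorem extendEdges (y : Bool) (H : Finset (Fin n × Fin n)) :
    Separated (extendEdges false y H) := by
  refine ⟨forall_fin_add_two.2 ?_, fun u => ?_⟩ <;> simp [mem_extendEdges, extendMatrix]

theorem influenced_zero (h : Separated L) {w : Fin (n + 2)} : Influenced L 0 w ↔ w = 0 := by
  rw [influenced_iff_reflTransGen]
  constructor
  · intro hw
    rcases hw.cases_head with h' | ⟨c, hc, -⟩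
    · exact h'.symm
    · exact absurd hc (h.1 c)
  · rintro rfl
    exact .refl

/-- A walk starting at an old voter never enters voter 0 or 1, so the live pairs leaving voter 1 are
irrelevant to it. -/
theorem influenced_shift (h : Separated L) {s : Fin n} {w : Fin (n + 2)} :
    Influenced L (shift s) w ↔ ∃ v, w = shift v ∧ Influenced (restrictEdges L) s v := by
  simp only [influenced_iff_reflTransGen]
  constructor
  · intro hw
    induction hw with
    | refl => exact ⟨s, rfl, .refl⟩
    | @tail b c _ hbc ih =>
      obtain ⟨v, rfl, hv⟩ := ih
      rcases eq_zero_or_one_or_shift c with rfl | rfl | ⟨c, rfl⟩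
      · exact absurd hbc (h.2 v).1
      · exact absurd hbc (h.2 v).2
      · exact ⟨c, rfl, hv.tail (mem_restrictEdges.2 hbc)⟩
  · rintro ⟨v, rfl, hv⟩
    exact hv.lift shift fun a b hab => mem_restrictEdges.1 hab

end Separated

/-! ### Bounds on the numbers in an instance -/

namespace Data

theorem lt_two_pow_size_ofNat (n : ℕ) : n < 2 ^ (ofNat n).size := by
  have hl : ∀ l : List Data, l.length ≤ (ofList l).size := by
    intro l
    induction l with
    | nil => simp
    | cons a l ih =>
      have : (ofList (a :: l)).size = a.size + (ofList l).size + 1 := rfl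
      simp only [List.length_cons]
      omega
  have h := hl (n.bits.map ofBool)
  rw [List.length_map, Nat.size_eq_bits_len] at h
  exact (Nat.lt_size_self n).trans_le (Nat.pow_le_pow_right (by norm_num) h)

theorem ofFamily_zero (f : Fin 0 → Data) : ofFamily f = nil := by
  simp [ofFamily, ofList]

theorem ofFamily_succ {n : ℕ} (f : Fin (n + 1) → Data) :
    ofFamily f = cons (f 0) (ofFamily fun i => f i.succ) := by
  simp [ofFamily, ofList, List.ofFn_succ]

/-- The exponent is the size of a `cons` of trees of sizes `x` and `y`. Bounds of the form "number
below 2 to the size" thus add up along an encoding. -/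
theorem add_lt_two_pow {a b x y : ℕ} (ha : a < 2 ^ x) (hb : b < 2 ^ y) :
    a + b < 2 ^ (x + y + 1) := by
  have hx : 1 ≤ 2 ^ x := Nat.one_le_two_pow
  have hy : 1 ≤ 2 ^ y := Nat.one_le_two_pow
  rw [pow_succ, pow_add]
  nlinarith

theorem sum_lt_two_pow_size_ofFamily {n : ℕ} (a : Fin n → ℕ) (f : Fin n → Data)
    (h : ∀ i, a i < 2 ^ (f i).size) : ∑ i, a i < 2 ^ (ofFamily f).size := by
  induction n with
  | zero => simp
  | succ n ih =>
    rw [Fin.sum_univ_succ, ofFamily_succ]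
    exact add_lt_two_pow (h 0) (ih _ _ fun i => h i.succ)

end Data

/-- `m + 1` distinct integers need an interval of length at least `m`. This makes room for the
scores `0, …, ℓ` of the new voters without raising the maximum or the spread. -/
theorem le_sup'_sub_inf'_of_injective {m : ℕ} {f : Fin (m + 1) → ℕ} (hf : f.Injective) :
    m ≤ Finset.univ.sup' Finset.univ_nonempty f - Finset.univ.inf' Finset.univ_nonempty f := by
  have h := Finset.card_le_card_of_injOn (s := Finset.univ)
    (t := Finset.Icc (Finset.univ.inf' Finset.univ_nonempty f)
      (Finset.univ.sup' Finset.univ_nonempty f)) f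
    (fun i _ => Finset.mem_coe.2 (Finset.mem_Icc.2
      ⟨Finset.inf'_le _ (Finset.mem_univ i), Finset.le_sup' _ (Finset.mem_univ i)⟩)) hf.injOn
  rw [Finset.card_univ, Fintype.card_fin, Nat.card_Icc] at h
  omega

namespace Instance

/-- The largest score. -/
def maxScore (I : Instance) : ℕ := Finset.univ.sup fun v => Finset.univ.sup fun i => I.score v i

theorem score_le_maxScore (I : Instance) (v : Fin I.n) (i : Fin (I.ℓ + 1)) :
    I.score v i ≤ I.maxScore :=
  (Finset.le_sup (f := I.score v) (Finset.mem_univ i)).trans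
    (Finset.le_sup (f := fun v => Finset.univ.sup fun i => I.score v i) (Finset.mem_univ v))

theorem ℓ_le_spread (I : Instance) : I.ℓ ≤ I.spread :=
  (le_sup'_sub_inf'_of_injective (I.score_injective ⟨0, I.n_pos⟩)).trans
    (Finset.le_sup (f := fun v => Finset.univ.sup' Finset.univ_nonempty (I.score v) -
      Finset.univ.inf' Finset.univ_nonempty (I.score v)) (Finset.mem_univ _))

theorem ℓ_le_maxScore (I : Instance) : I.ℓ ≤ I.maxScore := by
  have h := le_sup'_sub_inf'_of_injective (I.score_injective ⟨0, I.n_pos⟩)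
  obtain ⟨i, -, hi⟩ := Finset.exists_mem_eq_sup' Finset.univ_nonempty (I.score ⟨0, I.n_pos⟩)
  have := I.score_le_maxScore ⟨0, I.n_pos⟩ i
  omega

theorem eps_eq (I : Instance) : I.eps = 1 / (1 + (I.maxScore : ℚ)) := rfl

theorem eps_pos (I : Instance) : 0 < I.eps := by
  rw [eps_eq]; positivity

theorem eps_lt_one (I : Instance) : I.eps < 1 := by
  have h : (0 : ℚ) < I.maxScore := by exact_mod_cast I.ℓ_pos.trans_le I.ℓ_le_maxScore
  rw [eps_eq, div_lt_one (by positivity)]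
  linarith

/-- Scores and messages are all written in the encoding, so their total stays below 2 to its size.
Hence the message `2 ^ I.size` beats them all, although its binary length is only linear in
`I.size`. -/
theorem maxScore_add_sum_news_lt (I : Instance) :
    I.maxScore + ∑ s, ∑ i, (I.news s i).natAbs < 2 ^ I.size := by
  -- The maximum is replaced by the sum of all scores, which fits the summation over the encoding.
  have hmax : I.maxScore ≤ ∑ v, ∑ i, I.score v i := by
    refine Finset.sup_le fun v _ => Finset.sup_le fun i _ => ?_
    exact (Finset.single_le_sum (f := I.score v) (fun _ _ => Nat.zero_le _)
      (Finset.mem_univ i)).trans (Finset.single_le_sum (f := fun v => ∑ i, I.score v i)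
        (fun _ _ => Nat.zero_le _) (Finset.mem_univ v))
  refine (Nat.add_le_add_right hmax _).trans_lt ?_
  rw [← Finset.sum_add_distrib]
  refine (Data.sum_lt_two_pow_size_ofFamily _ _ fun v => ?_).trans_le
    (Nat.pow_le_pow_right (by norm_num) (Data.size_left_le I.encode))
  refine Data.add_lt_two_pow (Data.sum_lt_two_pow_size_ofFamily _ _ fun i =>
    Data.lt_two_pow_size_ofNat _) ?_
  cases hm : I.message v with
  | none => simp [news, hm]
  | some m =>
    have h := Data.sum_lt_two_pow_size_ofFamily (fun i => (m i).natAbs)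
      (fun i => Data.ofInt (m i)) fun i => (Data.lt_two_pow_size_ofNat _).trans_le
        (Nat.pow_le_pow_right (by norm_num) (by simp [Data.ofInt]; omega))
    simp only [news, hm]
    refine h.trans_le (Nat.pow_le_pow_right (by norm_num) ?_)
    simp [Data.ofOption]
    omega

/-! ### Margin of victory and the empty manipulation. -/

theorem mov_le (I : Instance) (A H : Finset (Fin I.n × Fin I.n)) : I.mov A H ≤ I.n := by
  have := Finset.card_le_univ (I.votersFor (A ∩ H) 0)
  rw [Fintype.card_fin] at this
  unfold mov
  omega

theorem mov_eq_of_forall_lt (I : Instance) (A H : Finset (Fin I.n × Fin I.n))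
    (h : ∀ v j, j ≠ 0 → I.finalScore (A ∩ H) v j < I.finalScore (A ∩ H) v 0) :
    I.mov A H = I.n := by
  have h0 : I.votersFor (A ∩ H) 0 = Finset.univ :=
    Finset.filter_true_of_mem fun v _ => h v
  have hc : ((Finset.univ.filter fun c : Fin (I.ℓ + 1) => c ≠ 0).sup
      fun c => (I.votersFor (A ∩ H) c).card) = 0 := by
    refine (Finset.sup_eq_bot_iff _ _).2 fun c hc => ?_
    have hc : c ≠ 0 := by simpa using hc
    refine Finset.card_eq_zero.2 ?_
    exact Finset.filter_false_of_mem fun v _ hv => lt_asymm (h v c hc) (hv 0 hc.symm)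
  simp [mov, h0, hc]

theorem liveProb_nonneg (I : Instance) (H : Finset (Fin I.n × Fin I.n)) : 0 ≤ I.liveProb H := by
  refine Finset.prod_nonneg fun e _ => ?_
  split_ifs
  · exact I.prob_nonneg e
  · exact sub_nonneg.2 (I.prob_le_one e)

theorem feasible_empty (I : Instance) (k : Modification) : I.Feasible k ∅ := by
  cases k <;> simp [Feasible]

theorem modify_empty (I : Instance) (k : Modification) : I.modify ∅ k = I.edges := by
  cases k <;> simp [modify]

theorem gain_empty (I : Instance) (k : Modification) : I.gain k ∅ = 0 := by
  simp [gain, modify_empty]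

/-- Two voters `0` and `1` who prefer `c_0` are added. Voter `0` is a seed whose message makes
everybody vote for `c_0`; it reaches the old voters through voter `1`, if the pair `(0, 1)`, which
has probability `p`, is live. -/
abbrev extend (I : Instance) (p : ℚ) (h0 : 0 ≤ p) (h1 : p ≤ 1) : Instance where
  n := I.n + 2
  n_pos := by omega
  ℓ := I.ℓ
  ℓ_pos := I.ℓ_pos
  -- These scores put `c_0` on top and stay in `0, …, ℓ`, which preserves unitarity, the largest
  -- score and the spread bound.
  score := extendFamily (fun i => I.ℓ - i) (fun i => I.ℓ - i) I.score
  score_injective := by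
    have h : Function.Injective fun i : Fin (I.ℓ + 1) => I.ℓ - (i : ℕ) := by
      intro i j hij
      simp only at hij
      ext
      omega
    exact forall_fin_add_two.2 ⟨h, h, I.score_injective⟩
  message := extendFamily (some fun i => if i = 0 then 2 ^ I.size else 0) none I.message
  edges := extendEdges true true I.edges
  prob e := extendMatrix p 1 0 (fun u v => I.prob (u, v)) e.1 e.2
  prob_nonneg := by
    rintro ⟨u, v⟩
    rcases eq_zero_or_one_or_shift u with rfl | rfl | ⟨u, rfl⟩ <;>
    rcases eq_zero_or_one_or_shift v with rfl | rfl | ⟨v, rfl⟩ <;>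
    simp [extendMatrix, h0, I.prob_nonneg]
  prob_le_one := by
    rintro ⟨u, v⟩
    rcases eq_zero_or_one_or_shift u with rfl | rfl | ⟨u, rfl⟩ <;>
    rcases eq_zero_or_one_or_shift v with rfl | rfl | ⟨v, rfl⟩ <;>
    simp [extendMatrix, h1, I.prob_le_one]
  budget := I.budget

section extend
variable (I : Instance) (p : ℚ) (h0 : 0 ≤ p) (h1 : p ≤ 1)

theorem extend_score_shift (v : Fin I.n) (i : Fin (I.ℓ + 1)) :
    (I.extend p h0 h1).score (shift v) i = I.score v i := rfl

theorem extend_message_shift (v : Fin I.n) :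
    (I.extend p h0 h1).message (shift v) = I.message v := rfl

theorem extend_news_shift (v : Fin I.n) (i : Fin (I.ℓ + 1)) :
    (I.extend p h0 h1).news (shift v) i = I.news v i := by
  unfold news
  rw [extend_message_shift]
  cases I.message v <;> rfl

/-- The tie-breaking parameter depends on the largest score; it must not change, or old voters could
vote differently. -/
theorem extend_maxScore : (I.extend p h0 h1).maxScore = I.maxScore := by
  apply le_antisymm
  · refine Finset.sup_le fun v _ => Finset.sup_le fun i _ => ?_
    revert v
    refine (forall_fin_add_two (n := I.n)).2 ⟨fun _ => ?_, fun _ => ?_, fun v _ => ?_⟩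
    · exact (Nat.sub_le _ _).trans I.ℓ_le_maxScore
    · exact (Nat.sub_le _ _).trans I.ℓ_le_maxScore
    · exact I.score_le_maxScore v i
  · refine Finset.sup_le fun v _ => Finset.sup_le fun i _ => ?_
    exact (I.extend p h0 h1).score_le_maxScore (shift v) i

theorem extend_eps : (I.extend p h0 h1).eps = I.eps := by
  rw [eps_eq, eps_eq, extend_maxScore]

theorem extend_spread_le : (I.extend p h0 h1).spread ≤ I.spread := by
  have hnew : ∀ f : Fin (I.ℓ + 1) → ℕ, (∀ i, f i ≤ I.ℓ) →
      Finset.univ.sup' Finset.univ_nonempty f - Finset.univ.inf' Finset.univ_nonempty f ≤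
        I.spread := fun f hf =>
    (Nat.sub_le _ _).trans ((Finset.sup'_le _ _ fun i _ => hf i).trans I.ℓ_le_spread)
  refine Finset.sup_le fun v _ => ?_
  revert v
  refine (forall_fin_add_two (n := I.n)).2 ⟨fun _ => ?_, fun _ => ?_, fun v _ => ?_⟩
  · exact hnew _ fun i => Nat.sub_le _ _
  · exact hnew _ fun i => Nat.sub_le _ _
  · exact Finset.le_sup (f := fun v => Finset.univ.sup' Finset.univ_nonempty (I.score v) -
      Finset.univ.inf' Finset.univ_nonempty (I.score v)) (Finset.mem_univ v)

theorem sameSetting_extend : I.SameSetting (I.extend p h0 h1) := by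
  refine ⟨rfl, rfl, fun h => (forall_fin_add_two (n := I.n)).2 ⟨fun i => ?_, fun i => ?_, h⟩⟩
  · exact Nat.sub_le _ _
  · exact Nat.sub_le _ _

open Classical in
theorem extend_finalScore (L : Finset (Fin (I.n + 2) × Fin (I.n + 2))) (w : Fin (I.n + 2))
    (i : Fin (I.ℓ + 1)) : (I.extend p h0 h1).finalScore L w i =
      (1 - I.eps) * ((I.extend p h0 h1).score w i : ℚ) +
      (((if Influenced L 0 w then if i = 0 then 2 ^ I.size else 0 else 0) +
        ∑ s ∈ Finset.univ.filter (fun s => (I.message s).isSome ∧ Influenced L (shift s) w),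
          I.news s i : ℤ) : ℚ) := by
  unfold finalScore
  rw [extend_eps]
  congr 2
  rw [Finset.sum_filter, Finset.sum_filter]
  refine (sum_fin_add_two (n := I.n) _).trans ?_
  congr 1
  · exact if_congr ⟨fun h => h.2, fun h => ⟨rfl, h⟩⟩ rfl rfl
  -- Voter 1 is no seed and contributes nothing.
  · refine (congrArg₂ _ (if_neg (by simp)) rfl).trans ?_
    rw [zero_add]
    exact Finset.sum_congr rfl fun s _ =>
      if_congr Iff.rfl (I.extend_news_shift p h0 h1 s i) rfl

/-! ### The extended instance when the new message does not spread -/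

theorem extend_finalScore_shift {L : Finset (Fin (I.n + 2) × Fin (I.n + 2))} (hL : Separated L)
    (v : Fin I.n) (i : Fin (I.ℓ + 1)) :
    (I.extend p h0 h1).finalScore L (shift v) i = I.finalScore (restrictEdges L) v i := by
  classical
  rw [extend_finalScore, extend_score_shift]
  simp [hL.influenced_zero, hL.influenced_shift, finalScore]

/-- No old message reaches voters 0 and 1. The only message they can receive is that of voter 0,
which favours `c_0`, and `1 - ε > 0` keeps the order of their initial scores. -/
theorem extend_finalScore_lt_of_new {L : Finset (Fin (I.n + 2) × Fin (I.n + 2))}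
    (hL : Separated L) {w : Fin (I.n + 2)} (hw : w = 0 ∨ w = 1) {j : Fin (I.ℓ + 1)} (hj : j ≠ 0) :
    (I.extend p h0 h1).finalScore L w j < (I.extend p h0 h1).finalScore L w 0 := by
  classical
  have hs : ∀ i, (I.extend p h0 h1).score w i = I.ℓ - i := by
    rcases hw with rfl | rfl <;> exact fun i => rfl
  have hw' : ∀ v, w ≠ shift v := by
    rcases hw with rfl | rfl <;> simp
  refine (extend_finalScore I p h0 h1 L w j).trans_lt
    (lt_of_lt_of_eq ?_ (extend_finalScore I p h0 h1 L w 0).symm)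
  rw [hs, hs]
  have he := I.eps_lt_one
  have hlt : ((I.ℓ - (j : ℕ) : ℕ) : ℚ) < ((I.ℓ - ((0 : Fin (I.ℓ + 1)) : ℕ) : ℕ) : ℚ) := by
    have : (j : ℕ) ≠ 0 := fun h => hj (Fin.ext h)
    have := I.ℓ_pos
    have h0 : ((0 : Fin (I.ℓ + 1)) : ℕ) = 0 := rfl
    exact_mod_cast (by omega)
  refine add_lt_add_of_lt_of_le (mul_lt_mul_of_pos_left hlt (by linarith)) ?_
  simp only [hL.influenced_shift, hw', hj, false_and, exists_false, and_false,
    Finset.filter_false, Finset.sum_empty, add_zero, if_false, ite_self, if_true]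
  split_ifs <;> simp

theorem extend_card_votersFor {L : Finset (Fin (I.n + 2) × Fin (I.n + 2))} (hL : Separated L)
    (c : Fin (I.ℓ + 1)) : ((I.extend p h0 h1).votersFor L c).card =
      (if c = 0 then 2 else 0) + (I.votersFor (restrictEdges L) c).card := by
  classical
  have hnew : ∀ w : Fin (I.n + 2), w = 0 ∨ w = 1 →
      ((∀ j, j ≠ c → (I.extend p h0 h1).finalScore L w j < (I.extend p h0 h1).finalScore L w c) ↔
        c = 0) := by
    intro w hw
    constructor
    · intro h
      by_contra hc
      exact lt_asymm (h 0 (Ne.symm hc)) (I.extend_finalScore_lt_of_new p h0 h1 hL hw hc)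
    · rintro rfl j hj
      exact I.extend_finalScore_lt_of_new p h0 h1 hL hw hj
  unfold votersFor
  rw [Finset.card_filter, Finset.card_filter]
  refine (sum_fin_add_two (n := I.n) _).trans ?_
  have e0 := hnew 0 (.inl rfl)
  have e1 := hnew 1 (.inr rfl)
  rw [← add_assoc]
  refine congrArg₂ _ ?_ (Finset.sum_congr rfl fun v _ => if_congr ?_ rfl rfl)
  · refine (congrArg₂ _ (if_congr e0 rfl rfl) (if_congr e1 rfl rfl)).trans ?_
    split_ifs <;> rfl
  · refine forall_congr' fun j => imp_congr Iff.rfl ?_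
    exact iff_of_eq (congrArg₂ _ (I.extend_finalScore_shift p h0 h1 hL v j)
      (I.extend_finalScore_shift p h0 h1 hL v c))

/-- The 2 counts the new voters, who both vote for `c_0` whatever happens; it cancels in every gain.
-/
theorem extend_mov {A H : Finset (Fin (I.n + 2) × Fin (I.n + 2))}
    {A' H' : Finset (Fin I.n × Fin I.n)} (hL : Separated (A ∩ H))
    (h : restrictEdges (A ∩ H) = A' ∩ H') :
    (I.extend p h0 h1).mov A H = I.mov A' H' + 2 := by
  have hc := I.extend_card_votersFor p h0 h1 hL
  rw [h] at hc
  have hsup : ((Finset.univ.filter fun c : Fin (I.ℓ + 1) => c ≠ 0).sup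
      fun c => ((I.extend p h0 h1).votersFor (A ∩ H) c).card) =
      (Finset.univ.filter fun c : Fin (I.ℓ + 1) => c ≠ 0).sup
        fun c => (I.votersFor (A' ∩ H') c).card := by
    refine Finset.sup_congr rfl fun c hc' => ?_
    have hc' : c ≠ 0 := by simpa using hc'
    rw [hc c, if_neg hc', zero_add]
  have h2 := hc 0
  rw [if_pos rfl] at h2
  have : (I.extend p h0 h1).mov A H =
      (((I.extend p h0 h1).votersFor (A ∩ H) (0 : Fin (I.ℓ + 1))).card : ℤ) -
      (((Finset.univ.filter fun c : Fin (I.ℓ + 1) => c ≠ 0).sup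
      fun c => ((I.extend p h0 h1).votersFor (A ∩ H) c).card : ℕ) : ℤ) := rfl
  rw [this, h2, hsup, mov]
  push_cast
  ring

theorem restrictEdges_extend_modify (k : Modification)
    (F : Finset (Fin (I.n + 2) × Fin (I.n + 2))) :
    restrictEdges ((I.extend p h0 h1).modify F k) = I.modify (restrictEdges F) k := by
  have he : ∀ u v, (shift u, shift v) ∈ (I.extend p h0 h1).edges ↔ (u, v) ∈ I.edges := fun u v =>
    (mem_restrictEdges (L := extendEdges true true I.edges)).symm.trans
      (by rw [restrictEdges_extendEdges])
  ext ⟨u, v⟩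
  rw [mem_restrictEdges]
  cases k
  · exact Finset.mem_sdiff.trans ((and_congr (he u v) (by rw [mem_restrictEdges])).trans
      Finset.mem_sdiff.symm)
  · exact Finset.mem_union.trans ((or_congr (he u v) (by rw [mem_restrictEdges])).trans
      Finset.mem_union.symm)

theorem restrictEdges_inter {n : ℕ} (A H : Finset (Fin (n + 2) × Fin (n + 2))) :
    restrictEdges (A ∩ H) = restrictEdges A ∩ restrictEdges H := by
  ext ⟨u, v⟩
  simp

/-- Every pair with a new voter has probability 0 or 1, and `extendEdges false true H` agrees with
all of them, so these pairs contribute factors 1. -/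
theorem extend_zero_liveProb (H : Finset (Fin I.n × Fin I.n)) :
    (I.extend 0 le_rfl zero_le_one).liveProb (extendEdges false true H) = I.liveProb H := by
  refine (Fintype.prod_of_injective (fun e : Fin I.n × Fin I.n => (shift e.1, shift e.2)) ?_ _ _
    ?_ ?_).symm
  · rintro ⟨u, v⟩ ⟨u', v'⟩ h
    simpa using h
  · rintro ⟨u, v⟩ h
    change (if (u, v) ∈ extendEdges false true H then
      extendMatrix 0 1 0 (fun u v => I.prob (u, v)) u v else
      1 - extendMatrix 0 1 0 (fun u v => I.prob (u, v)) u v) = (1 : ℚ)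
    simp only [mem_extendEdges]
    rcases eq_zero_or_one_or_shift u with rfl | rfl | ⟨u, rfl⟩ <;>
    rcases eq_zero_or_one_or_shift v with rfl | rfl | ⟨v, rfl⟩ <;>
    first
    | exact absurd ⟨(_, _), rfl⟩ h
    | simp [extendMatrix]
  · rintro ⟨u, v⟩
    change _ = if (shift u, shift v) ∈ extendEdges false true H then I.prob (u, v) else
      1 - I.prob (u, v)
    simp [mem_extendEdges, extendMatrix]

/-- A live set disagreeing with a pair of probability 0 or 1 has a factor 0. Only extensions of old
live sets matter in the expectation. -/
theorem eq_extendEdges_of_liveProb_ne_zero {H : Finset (Fin (I.n + 2) × Fin (I.n + 2))}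
    (h : (I.extend 0 le_rfl zero_le_one).liveProb H ≠ 0) :
    H = extendEdges false true (restrictEdges H) := by
  have h' : ∀ u v, (if (u, v) ∈ H then extendMatrix 0 1 0 (fun u v => I.prob (u, v)) u v else
      1 - extendMatrix 0 1 0 (fun u v => I.prob (u, v)) u v) ≠ (0 : ℚ) := fun u v =>
    Finset.prod_ne_zero_iff.1 h (u, v) (Finset.mem_univ _)
  ext ⟨u, v⟩
  specialize h' u v
  rw [mem_extendEdges]
  rcases eq_zero_or_one_or_shift u with rfl | rfl | ⟨u, rfl⟩ <;>
  rcases eq_zero_or_one_or_shift v with rfl | rfl | ⟨v, rfl⟩ <;>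
  simp [extendMatrix] at h' ⊢ <;> exact h'

theorem extend_zero_gain (k : Modification) (F : Finset (Fin (I.n + 2) × Fin (I.n + 2))) :
    (I.extend 0 le_rfl zero_le_one).gain k F = I.gain k (restrictEdges F) := by
  have hmov : ∀ (F : Finset (Fin (I.n + 2) × Fin (I.n + 2))) (H : Finset (Fin I.n × Fin I.n)),
      (I.extend 0 le_rfl zero_le_one).mov ((I.extend 0 le_rfl zero_le_one).modify F k)
        (extendEdges false true H) = I.mov (I.modify (restrictEdges F) k) H + 2 := by
    intro F H
    refine I.extend_mov 0 le_rfl zero_le_one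
      ((Separated.extendEdges true H).mono Finset.inter_subset_right) ?_
    refine (restrictEdges_inter _ _).trans ?_
    rw [restrictEdges_extend_modify, restrictEdges_extendEdges]
  have hbase : ∀ H : Finset (Fin I.n × Fin I.n),
      (I.extend 0 le_rfl zero_le_one).mov (I.extend 0 le_rfl zero_le_one).edges
        (extendEdges false true H) = I.mov I.edges H + 2 := by
    intro H
    -- The unmodified edge set is treated as the modification by `∅`.
    have h := hmov ∅ H
    have he : restrictEdges (∅ : Finset (Fin (I.n + 2) × Fin (I.n + 2))) = ∅ := by
      simp [restrictEdges]
    rwa [he, modify_empty, modify_empty] at h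
  refine (Fintype.sum_of_injective (extendEdges (n := I.n) false true) extendEdges_injective
    _ _ ?_ ?_).symm
  · intro H hH
    by_cases h : (I.extend 0 le_rfl zero_le_one).liveProb H = 0
    · exact mul_eq_zero_of_left h _
    · exact absurd ⟨_, (I.eq_extendEdges_of_liveProb_ne_zero h).symm⟩ hH
  · intro H
    rw [hmov, hbase, extend_zero_liveProb]
    congr 2
    ring

theorem Feasible.restrictEdges {I : Instance} {p : ℚ} {h0 : 0 ≤ p} {h1 : p ≤ 1}
    {k : Modification} {F : Finset (Fin (I.n + 2) × Fin (I.n + 2))}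
    (h : (I.extend p h0 h1).Feasible k F) : I.Feasible k (restrictEdges F) := by
  obtain ⟨hF, hc⟩ := h
  refine ⟨?_, le_trans (by exact_mod_cast card_restrictEdges_le F) hc⟩
  have he : ∀ u v, (shift u, shift v) ∈ extendEdges true true I.edges → (u, v) ∈ I.edges :=
    fun u v huv => by
      rw [← restrictEdges_extendEdges (x := true) (y := true) (L := I.edges)]
      exact mem_restrictEdges.2 huv
  cases k
  · rintro ⟨u, v⟩ huv
    exact he u v (hF (mem_restrictEdges.1 huv))
  · refine Finset.disjoint_left.2 ?_
    rintro ⟨u, v⟩ huv hE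
    refine Finset.disjoint_left.1 hF (mem_restrictEdges.1 huv) ?_
    rw [← restrictEdges_extendEdges (x := true) (y := true) (L := I.edges)] at hE
    exact mem_restrictEdges.1 hE

/-- An old solution is used unchanged and touches no new pair, so the budget is kept. -/
theorem Feasible.extendEdges {I : Instance} (p : ℚ) (h0 : 0 ≤ p) (h1 : p ≤ 1)
    {k : Modification} {F : Finset (Fin I.n × Fin I.n)} (h : I.Feasible k F) :
    (I.extend p h0 h1).Feasible k (extendEdges false false F) := by
  obtain ⟨hF, hc⟩ := h
  refine ⟨?_, le_trans (le_of_eq (congrArg _ (card_extendEdges_false F))) hc⟩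
  cases k
  · have : ∀ u v, (u, v) ∈ _root_.extendEdges false false F →
        (u, v) ∈ _root_.extendEdges true true I.edges := by
      intro u v
      simp only [mem_extendEdges]
      rcases eq_zero_or_one_or_shift u with rfl | rfl | ⟨u, rfl⟩ <;>
      rcases eq_zero_or_one_or_shift v with rfl | rfl | ⟨v, rfl⟩ <;>
      simp [extendMatrix]
      exact @hF (u, v)
    exact fun e => this e.1 e.2
  · have : ∀ u v, (u, v) ∈ _root_.extendEdges false false F →
        (u, v) ∉ _root_.extendEdges true true I.edges := by
      intro u v
      simp only [mem_extendEdges]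
      rcases eq_zero_or_one_or_shift u with rfl | rfl | ⟨u, rfl⟩ <;>
      rcases eq_zero_or_one_or_shift v with rfl | rfl | ⟨v, rfl⟩ <;>
      simp [extendMatrix]
      exact fun huv => Finset.disjoint_left.1 hF huv
    exact Finset.disjoint_left.2 fun e => this e.1 e.2

/-! ### The extended instance when the new message reaches everybody -/

theorem extend_finalScore_lt {L : Finset (Fin (I.n + 2) × Fin (I.n + 2))} (h01 : (0, 1) ∈ L)
    (h1v : ∀ v, (1, shift v) ∈ L) (w : Fin (I.n + 2)) {j : Fin (I.ℓ + 1)} (hj : j ≠ 0) :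
    (I.extend p h0 h1).finalScore L w j < (I.extend p h0 h1).finalScore L w 0 := by
  classical
  have hinf : Influenced L 0 w := by
    rw [influenced_iff_reflTransGen]
    rcases eq_zero_or_one_or_shift w with rfl | rfl | ⟨v, rfl⟩
    · exact .refl
    · exact .single h01
    · exact (Relation.ReflTransGen.single h01).tail (h1v v)
  refine (extend_finalScore I p h0 h1 L w j).trans_lt
    (lt_of_lt_of_eq ?_ (extend_finalScore I p h0 h1 L w 0).symm)
  rw [if_pos hinf, if_pos hinf, if_neg hj, if_pos rfl]
  set S := Finset.univ.filter fun s => (I.message s).isSome ∧ Influenced L (shift s) w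
  -- Since `j ≠ 0`, the news on `c_j` and on `c_0` are different terms of the total, so a single
  -- copy of it bounds both.
  have hsum : |∑ s ∈ S, I.news s j| + |∑ s ∈ S, I.news s 0| ≤
      ∑ s, ∑ i, ((I.news s i).natAbs : ℤ) := by
    calc _ ≤ ∑ s ∈ S, |I.news s j| + ∑ s ∈ S, |I.news s 0| :=
          add_le_add (Finset.abs_sum_le_sum_abs _ _) (Finset.abs_sum_le_sum_abs _ _)
      _ = ∑ s ∈ S, (|I.news s j| + |I.news s 0|) := Finset.sum_add_distrib.symm
      _ ≤ ∑ s ∈ S, ∑ i, ((I.news s i).natAbs : ℤ) := by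
          refine Finset.sum_le_sum fun s _ => ?_
          simp only [Int.natCast_natAbs]
          rw [← Finset.sum_pair (f := fun i => |I.news s i|) hj]
          exact Finset.sum_le_sum_of_subset_of_nonneg (Finset.subset_univ _)
            fun _ _ _ => abs_nonneg _
      _ ≤ _ := Finset.sum_le_sum_of_subset_of_nonneg (Finset.subset_univ _)
            fun _ _ _ => Finset.sum_nonneg fun _ _ => by positivity
  have hlt : (I.maxScore : ℤ) + ∑ s, ∑ i, ((I.news s i).natAbs : ℤ) < 2 ^ I.size := by
    exact_mod_cast I.maxScore_add_sum_news_lt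
  have hz : (I.maxScore : ℤ) + ∑ s ∈ S, I.news s j < 2 ^ I.size + ∑ s ∈ S, I.news s 0 := by
    have := le_abs_self (∑ s ∈ S, I.news s j)
    have := neg_abs_le (∑ s ∈ S, I.news s 0)
    linarith
  have hq : (I.maxScore : ℚ) + ((∑ s ∈ S, I.news s j : ℤ) : ℚ) <
      ((2 ^ I.size + ∑ s ∈ S, I.news s 0 : ℤ) : ℚ) := by
    exact_mod_cast hz
  have hsc : ((I.extend p h0 h1).score w j : ℚ) ≤ I.maxScore := by
    have := (I.extend p h0 h1).score_le_maxScore w j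
    rw [extend_maxScore] at this
    exact_mod_cast this
  have he := I.eps_lt_one
  have he' := I.eps_pos
  -- Worst case for `c_0`: its rival starts with the largest score and `c_0` with 0.
  have hle : (1 - I.eps) * ((I.extend p h0 h1).score w j : ℚ) ≤ I.maxScore :=
    (mul_le_of_le_one_left (by positivity) (by linarith)).trans hsc
  have hge : 0 ≤ (1 - I.eps) * ((I.extend p h0 h1).score w (0 : Fin (I.ℓ + 1)) : ℚ) :=
    mul_nonneg (by linarith) (by positivity)
  rw [zero_add]
  linarith

theorem zero_one_mem_extend_edges :
    ((0, 1) : Fin (I.n + 2) × Fin (I.n + 2)) ∈ (I.extend p h0 h1).edges := by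
  simp [mem_extendEdges, extendMatrix]

theorem one_shift_mem_extend_edges (v : Fin I.n) :
    ((1, shift v) : Fin (I.n + 2) × Fin (I.n + 2)) ∈ (I.extend p h0 h1).edges := by
  simp [mem_extendEdges, extendMatrix]

/-- A margin never exceeds the number of voters. If this value is attained almost surely already, no
manipulation has positive gain, while `∅` has gain 0. -/
theorem isOptimal_empty_of_mov_eq (J : Instance) (k : Modification)
    (h : ∀ H, J.liveProb H ≠ 0 → J.mov J.edges H = J.n) : J.IsOptimal k ∅ := by
  refine ⟨feasible_empty _ k, fun F _ => ?_⟩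
  rw [gain_empty]
  refine Finset.sum_nonpos fun H _ => ?_
  by_cases hH : J.liveProb H = 0
  · rw [hH, zero_mul]
  · refine mul_nonpos_of_nonneg_of_nonpos (J.liveProb_nonneg H) (Int.cast_nonpos.2 ?_)
    rw [h H hH]
    exact sub_nonpos.2 (mov_le _ _ H)

theorem isOptimal_extend_one (k : Modification) :
    (I.extend 1 zero_le_one le_rfl).IsOptimal k ∅ := by
  refine isOptimal_empty_of_mov_eq _ k fun (H : Finset (Fin (I.n + 2) × Fin (I.n + 2))) h => ?_
  have h' : ∀ u v : Fin (I.n + 2), (if (u, v) ∈ H then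
      extendMatrix 1 1 0 (fun u v => I.prob (u, v)) u v else
      1 - extendMatrix 1 1 0 (fun u v => I.prob (u, v)) u v) ≠ (0 : ℚ) := fun u v =>
    Finset.prod_ne_zero_iff.1 h (u, v) (Finset.mem_univ _)
  have h01 : ((0, 1) : Fin (I.n + 2) × Fin (I.n + 2)) ∈ H := by
    by_contra hn
    have := h' 0 1
    rw [if_neg hn] at this
    simp [extendMatrix] at this
  have h1v : ∀ v : Fin I.n, ((1, shift v) : Fin (I.n + 2) × Fin (I.n + 2)) ∈ H := by
    intro v
    by_contra hn
    have := h' 1 (shift v)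
    rw [if_neg hn] at this
    simp [extendMatrix] at this
  refine mov_eq_of_forall_lt _ _ _ fun w j hj => ?_
  refine I.extend_finalScore_lt 1 zero_le_one le_rfl ?_ (fun v => ?_) w hj
  · exact Finset.mem_inter.2 ⟨I.zero_one_mem_extend_edges _ _ _, h01⟩
  · exact Finset.mem_inter.2 ⟨I.one_shift_mem_extend_edges _ _ _ v, h1v v⟩

end extend
end Instance

/-! ### The reduction on encodings -/

namespace Data

theorem ofFamily_add_two {n : ℕ} (f : Fin (n + 2) → Data) :
    ofFamily f = cons (f 0) (cons (f 1) (ofFamily fun v => f (shift v))) := by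
  rw [ofFamily_succ, ofFamily_succ]
  rfl

theorem map_ofFamily {n : ℕ} (g : Data → Data) (f : Fin n → Data) :
    (ofFamily f).map g = ofFamily fun i => g (f i) := by
  induction n with
  | zero => simp [ofFamily_zero, map]
  | succ n ih => rw [ofFamily_succ, ofFamily_succ, map, ih]

theorem size_le_size_map {g : Data → Data} (hg : ∀ x, x.size ≤ (g x).size) (x : Data) :
    x.size ≤ (x.map g).size := by
  induction x with
  | nil => simp [map]
  | cons a b _ ih =>
    have := hg a
    simp only [map, size_cons]
    omega

theorem ofNat_zero : ofNat 0 = nil := by simp [ofNat, ofList]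

theorem ofNat_two_mul {n : ℕ} (hn : n ≠ 0) : ofNat (2 * n) = cons nil (ofNat n) := by
  simp [ofNat, Nat.bit0_bits n hn, ofList, ofBool]

theorem ofNat_two_mul_add_one (n : ℕ) :
    ofNat (2 * n + 1) = cons (ofBool true) (ofNat n) := by
  simp [ofNat, ofList]

theorem succ_ofNat (n : ℕ) : (ofNat n).succ = ofNat (n + 1) := by
  induction n using Nat.strong_induction_on with
  | _ n ih =>
    rcases Nat.even_or_odd' n with ⟨m, rfl | rfl⟩
    · rcases eq_or_ne m 0 with rfl | hm
      · simp [ofNat, ofList, succ]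
      · rw [ofNat_two_mul hm, ofNat_two_mul_add_one, succ, cond_nil]
    · rw [ofNat_two_mul_add_one, show 2 * m + 1 + 1 = 2 * (m + 1) by ring,
        ofNat_two_mul (Nat.succ_ne_zero m), ← ih m (by omega)]
      rfl

/-- Only the length of the list matters, so the scores `ℓ - i` can be read off any list with one
entry per candidate. -/
theorem countdown_ofFamily {n : ℕ} (f : Fin (n + 1) → Data) :
    (ofFamily f).countdown = ofFamily fun i : Fin (n + 1) => ofNat (n - i) := by
  induction n with
  | zero => simp [ofFamily_succ, ofFamily_zero, countdown, ofNat_zero]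
  | succ n ih =>
    rw [ofFamily_succ, countdown, ih, ofFamily_succ (n := n + 1)]
    have h : (ofFamily fun i : Fin (n + 1) => ofNat (n + 1 - i.succ)) =
        ofFamily fun i : Fin (n + 1) => ofNat (n - i) := by
      simp
    rw [h, ofFamily_succ (n := n)]
    simp [succ_ofNat]

/-- Encoding of a pair of voters that is no edge and has probability `0`. -/
def deadPair : Data := cons (ofBool false) (ofRat 0)

/-- Encoding of an edge with probability `1`. -/
def livePair : Data := cons (ofBool true) (ofRat 1)

/-- The scores of the new voters, computed from the encoding of an instance. -/
def newScores (x : Data) : Data := x.left.left.left.countdown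

/-- The message of the new seed, computed from the encoding of an instance. -/
def newMessage (x : Data) : Data :=
  cons (cons nil (powTwo x.size)) (x.newScores.right.map fun _ => ofInt 0)

/-- The edges and probabilities of the extended instance, computed from those of an instance. -/
def newMatrix (y : Data) : Data :=
  cons (cons deadPair (cons livePair (y.map fun _ => deadPair)))
    (cons (cons deadPair (cons deadPair (y.map fun _ => livePair)))
      (y.map fun r => cons deadPair (cons deadPair r)))

/-- The extended instance, computed from the encoding of an instance. -/
def newInstance (x : Data) : Data :=
  cons (cons (cons x.newScores (cons nil x.newMessage)) (cons (cons x.newScores nil) x.left))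
    (cons x.right.left.newMatrix x.right.right)

/-- The reoptimization input, computed from the encoding of an instance. -/
def newReopt (x : Data) : Data :=
  -- The empty solution is the all-false matrix, obtained by overwriting every entry with `nil`.
  cons x.newInstance (cons (x.right.left.newMatrix.map fun r => r.map fun _ => nil)
    (cons (cons (ofNat 0) (ofNat 1)) (ofRat 0)))

/-- Delete the first two rows and columns of a matrix. -/
def minor (x : Data) : Data := x.right.right.map fun r => r.right.right

theorem minor_ofEdges {n : ℕ} (F : Finset (Fin (n + 2) × Fin (n + 2))) :
    (ofEdges F).minor = ofEdges (restrictEdges F) := by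
  simp only [minor, ofEdges, ofFamily_add_two, right_cons, map_ofFamily, mem_restrictEdges]

end Data

namespace PolyTime

theorem newScores : PolyTime Data.newScores := PolyTime.countdown.comp id.left.left.left

theorem newMessage : PolyTime Data.newMessage :=
  .pair (.pair (.const _) .powTwo_size) (PolyTime.comp (.map (.const _)) newScores.right)

theorem newMatrix : PolyTime Data.newMatrix :=
  .pair (.pair (.const _) (.pair (.const _) (.map (.const _))))
    (.pair (.pair (.const _) (.pair (.const _) (.map (.const _))))
      (.map (.pair (.const _) (.pair (.const _) id))))

theorem newReopt : PolyTime Data.newReopt :=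
  .pair (.pair (.pair (.pair newScores (.pair (.const _) newMessage))
      (.pair (.pair newScores (.const _)) id.left))
    (.pair (newMatrix.comp id.right.left) id.right.right))
    (.pair (PolyTime.comp (.map (.map (.const _))) (newMatrix.comp id.right.left)) (.const _))

/-- This is the map `g`: its input is a pair of an instance and a solution, and only the solution is
needed. -/
theorem minor_right : PolyTime fun x => x.right.minor :=
  (PolyTime.map id.right.right).comp id.right.right.right

end PolyTime

namespace Instance

/-- The list used is the score list of the first old voter, which exists because `I.n_pos` holds. -/
theorem newScores_encode (I : Instance) :
    I.encode.newScores = Data.ofFamily fun i : Fin (I.ℓ + 1) => Data.ofNat (I.ℓ - i) := by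
  have h : ∀ (m : ℕ) (hm : 0 < m) (f : Fin m → Data), (Data.ofFamily f).left = f ⟨0, hm⟩ := by
    intro m hm f
    obtain ⟨m, rfl⟩ := Nat.exists_eq_succ_of_ne_zero hm.ne'
    rw [Data.ofFamily_succ]
    rfl
  rw [Data.newScores, encode, Data.left_cons, h _ I.n_pos, Data.left_cons,
    Data.countdown_ofFamily]

theorem newMessage_encode (I : Instance) : I.encode.newMessage =
    Data.ofFamily fun i : Fin (I.ℓ + 1) => Data.ofInt (if i = 0 then 2 ^ I.size else 0) := by
  rw [Data.newMessage, newScores_encode, Data.ofFamily_succ, Data.right_cons, Data.map_ofFamily,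
    Data.ofFamily_succ]
  congr 1
  rw [← Data.ofNat_two_pow, if_pos rfl, Data.ofInt]
  have h : ¬ (2 ^ I.size : ℤ) < 0 := not_lt.2 (by positivity)
  rw [decide_eq_false h, Int.natAbs_pow]
  rfl

theorem newInstance_encode (I : Instance) :
    I.encode.newInstance = (I.extend 1 zero_le_one le_rfl).encode := by
  rw [Data.newInstance, newScores_encode, newMessage_encode]
  unfold encode
  simp only [Data.left_cons, Data.right_cons]
  congr 2
  · simp only [Data.ofFamily_add_two, extendFamily_zero, extendFamily_one, extendFamily_shift]
    rfl
  · simp only [Data.newMatrix, Data.map_ofFamily, Data.ofFamily_add_two, mem_extendEdges,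
      extendMatrix, extendFamily_zero, extendFamily_one, extendFamily_shift, Bool.decide_eq_true]
    rfl

/-- The spread bound is relative to the size of the instance, so it passes to the extension only
because the encoding does not shrink. -/
theorem size_le_size_extend (I : Instance) : I.size ≤ (I.extend 1 zero_le_one le_rfl).size := by
  have h := I.newInstance_encode
  obtain ⟨V, E, b, he⟩ : ∃ V E b, I.encode = .cons V (.cons E b) := ⟨_, _, _, rfl⟩
  have := Data.size_le_size_map (g := fun r => .cons Data.deadPair (.cons Data.deadPair r))
    (fun x => by simp only [Data.size_cons]; omega) E
  unfold size
  rw [← h, he]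
  simp only [Data.newInstance, Data.newMatrix, Data.left_cons, Data.right_cons, Data.size_cons]
  omega

/-- The reoptimization input whose changed instance is equivalent to `I`. -/
abbrev toReopt (I : Instance) : ReoptInstance where
  inst := I.extend 1 zero_le_one le_rfl
  sol := ∅
  edge := ((0, 1) : Fin (I.n + 2) × Fin (I.n + 2))
  newProb := 0
  newProb_nonneg := le_rfl
  newProb_le_one := zero_le_one

theorem newReopt_encode (I : Instance) : I.encode.newReopt = I.toReopt.encode := by
  rw [Data.newReopt, newInstance_encode, ReoptInstance.encode]
  congr 2
  have h : I.encode.right.left.newMatrix = I.encode.newInstance.right.left := rfl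
  rw [h, newInstance_encode, encode, Data.right_cons, Data.left_cons, Data.map_ofFamily,
    Data.ofEdges]
  congr 1
  funext u
  rw [Data.map_ofFamily]
  simp [Data.ofBool]

theorem toReopt_modified (I : Instance) :
    I.toReopt.modified = I.extend 0 le_rfl zero_le_one := by
  dsimp only [ReoptInstance.modified]
  congr 1
  funext ⟨u, v⟩
  rcases eq_zero_or_one_or_shift u with rfl | rfl | ⟨u, rfl⟩ <;>
  rcases eq_zero_or_one_or_shift v with rfl | rfl | ⟨v, rfl⟩ <;>
  simp [extendMatrix]

theorem SpreadBounded.extend {I : Instance} {q : Polynomial ℕ} (h : I.SpreadBounded q) :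
    (I.extend 1 zero_le_one le_rfl).SpreadBounded q :=
  (I.extend_spread_le _ _ _).trans (h.trans (q.eval_mono_nat I.size_le_size_extend))

/-! ### Transfer of inapproximability. -/

theorem IsApprox.gain_nonneg {I : Instance} {k : Modification} {ρ : NNReal}
    {F : Finset (Fin I.n × Fin I.n)} (h : I.IsApprox k ρ F) : (0 : ℝ) ≤ I.gain k F := by
  have := h.2 ∅ (I.feasible_empty k)
  rwa [gain_empty, Rat.cast_zero, mul_zero] at this

end Instance

/-- A value-preserving polynomial-time reduction transfers approximability from reoptimization to
optimization. -/
theorem optApproximable_of_reopt {k : Modification} {K K' : Set Instance} {ρ ρ' : ℕ → NNReal}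
    {f g : Prog} {r : Polynomial ℕ} (hρ : ∀ n, ∀ m ≤ r.eval n, ρ' n ≤ ρ m)
    (hred : ∀ I ∈ K, ∃ R : ReoptInstance,
      f.RunsWithin r I.encode R.encode ∧ R.Valid k ∧ R.inst ∈ K' ∧
      (∀ F, R.modified.Feasible k F →
        ∃ F', g.RunsWithin r (.cons I.encode (Data.ofEdges F)) (Data.ofEdges F') ∧
          I.Feasible k F' ∧ I.gain k F' = R.modified.gain k F) ∧
      (∀ F', I.Feasible k F' →
        ∃ F, R.modified.Feasible k F ∧ R.modified.gain k F = I.gain k F'))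
    (h : ReoptApproximable k K' ρ) : OptApproximable k K ρ' := by
  obtain ⟨c, r', hc⟩ := h
  let r₁ := r + r'.comp r + 1
  let r₂ := 1 + .X + (1 + .X) + r₁ + r₁ + 2
  -- The program keeps a copy of its input, since `g` expects the original instance next to the
  -- solution found.
  refine ⟨.seq (.pair .id (.seq f c)) g, r₂ + r.comp r₂ + 1, fun I hI => ?_⟩
  obtain ⟨R, hf, hV, hK', hg, hback⟩ := hred I hI
  obtain ⟨F, hF, hrun⟩ := hc R hV hK'
  obtain ⟨F', hg, hF', hgain⟩ := hg F hF.1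
  refine ⟨F', ⟨hF', fun F'' hF'' => ?_⟩,
    ((Prog.RunsWithin.id I.encode).pair (hf.seq hrun)).seq hg⟩
  obtain ⟨G, hG, hGgain⟩ := hback F'' hF''
  -- Each step pays for the tree it delivers, so the size of `R` is at most the cost of `f`; this is
  -- why the condition on `ρ` and `ρ'` ranges over `m ≤ r.eval n`.
  have hle : ρ' I.size ≤ ρ R.size := hρ _ _ hf.size_le
  rw [hgain, ← hGgain]
  -- Replacing `ρ'` by the larger `ρ` is sound only for a nonnegative gain; against a negative one,
  -- comparison with `∅` suffices.
  rcases le_total 0 (R.modified.gain k G : ℝ) with h0 | h0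
  · exact (mul_le_mul_of_nonneg_right (by exact_mod_cast hle) h0).trans (hF.2 G hG)
  · exact (mul_nonpos_of_nonneg_of_nonpos (by positivity) h0).trans hF.gain_nonneg

theorem mainTheorem12 (k : Modification) (q : Polynomial ℕ) :
    ∃ (f g : Prog) (r : Polynomial ℕ),
      -- a polynomial-time reduction from optimization to reoptimization that preserves values
      (∀ I : Instance, I.SpreadBounded q →
        ∃ R : ReoptInstance,
          f.RunsWithin r I.encode R.encode ∧
          R.Valid k ∧ R.inst.SpreadBounded q ∧ I.SameSetting R.inst ∧
          (∀ F, R.modified.Feasible k F →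
            ∃ F', g.RunsWithin r (.cons I.encode (Data.ofEdges F)) (Data.ofEdges F') ∧
              I.Feasible k F' ∧ I.gain k F' = R.modified.gain k F) ∧
          (∀ F', I.Feasible k F' →
            ∃ F, R.modified.Feasible k F ∧ R.modified.gain k F = I.gain k F')) ∧
      -- hence inapproximability carries over from optimization to reoptimization
      (∀ (K : Set Instance), (∀ I ∈ K, I.SpreadBounded q) →
        ∀ ρ ρ' : ℕ → NNReal, (∀ n, ∀ m ≤ r.eval n, ρ' n ≤ ρ m) →
          ¬ OptApproximable k K ρ' →
          ¬ ReoptApproximable k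
              {I' | I'.SpreadBounded q ∧ ∃ I ∈ K, I.SameSetting I'} ρ) := by

  obtain ⟨f, rf, hf⟩ := PolyTime.newReopt
  obtain ⟨g, rg, hg⟩ := PolyTime.minor_right
  have hred : ∀ I : Instance, I.SpreadBounded q → ∃ R : ReoptInstance,
      f.RunsWithin (rf + rg) I.encode R.encode ∧
      R.Valid k ∧ R.inst.SpreadBounded q ∧ I.SameSetting R.inst ∧
      (∀ F, R.modified.Feasible k F →
        ∃ F', g.RunsWithin (rf + rg) (.cons I.encode (Data.ofEdges F)) (Data.ofEdges F') ∧
          I.Feasible k F' ∧ I.gain k F' = R.modified.gain k F) ∧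
      (∀ F', I.Feasible k F' →
        ∃ F, R.modified.Feasible k F ∧ R.modified.gain k F = I.gain k F') := by
    intro I hI
    refine ⟨I.toReopt, ?_,
      ⟨I.isOptimal_extend_one k, I.zero_one_mem_extend_edges 1 zero_le_one le_rfl⟩,
      hI.extend, I.sameSetting_extend 1 zero_le_one le_rfl, ?_⟩
    · rw [← I.newReopt_encode]
      exact (hf _).mono fun n => by simp
    · rw [I.toReopt_modified]
      refine ⟨fun F hF => ⟨restrictEdges F, ?_, hF.restrictEdges, (I.extend_zero_gain k F).symm⟩,
        fun F' hF' => ⟨extendEdges false false F', hF'.extendEdges _ _ _, ?_⟩⟩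
      · have h : g.RunsWithin rg (.cons I.encode (Data.ofEdges F)) (Data.ofEdges F).minor := hg _
        rw [Data.minor_ofEdges] at h
        exact h.mono fun n => by simp
      · rw [I.extend_zero_gain, restrictEdges_extendEdges]
  refine ⟨f, g, rf + rg, hred, fun K hK ρ ρ' hρ hopt hreopt => hopt ?_⟩
  refine optApproximable_of_reopt (f := f) (g := g) hρ (fun I hI => ?_) hreopt
  obtain ⟨R, h1, h2, h3, h4, h5, h6⟩ := hred I (hK I hI)
  exact ⟨R, h1, h2, ⟨h3, I, hI, h4⟩, h5, h6⟩
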